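/- The following is a theorem of $\mathrm{ZF}+\mathrm{DC}$ (Zermelo–Fraenkel set theory without the axiom of choice, together with the axiom of dependent choice); that is, it holds in every model $(M,\in)$ of $\mathrm{ZF}+\mathrm{DC}$, where all notions ($\omega$, $\mathbb{R}$, $\mathbb{Q}$, Polish group, countable, finite, ...) are interpreted inside $M$. A Vitali set is a set $T\subseteq\mathbb{R}$ that intersects every translate $x+\mathbb{Q}$ ($x\in\mathbb{R}$) in exactly one point. A Polish group is a topological group whose topology is separable and completely metrizable. The index of a subgroup $F$ in a group $K\supseteq F$ is the cardinality of the set $\{gF : g\in K\}$ of left cosets; "countable" includes "finite". Suppose that there is no Vitali set. Let $G$ be a Polish group and let $F\leqslant G$ be a subgroup of countable index. Then there is an open subgroup $G_0\leqslant G$ such that $F\leqslant G_0$ and $F$ has finite index in $G_0$. If furthermore $F$ is normal in $G$, then $G_0$ can be chosen normal in $G$. -/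

import Mathlib

/-! # Models of ZF + DC and the internal notions of a model

`M` is a type with a binary relation `∈`, i.e. a structure for the language of set theory.  Elements
of `M` are the sets of the model.  It may be ill-founded and its `ω` nonstandard, so every notion
below is the model's own: quantifiers over sets, functions, sequences, metrics and the like range
over elements of `M` only. -/

namespace SetModel

universe u

/-! ## The language of set theory and the axioms of ZF + DC -/

/-- The only non-logical symbol: the binary membership symbol. -/
inductive MemRel : ℕ → Type
  | mem : MemRel 2

/-- The first-order language of set theory. -/
def setLang : FirstOrder.Language.{0, 0} := ⟨fun _ => Empty, MemRel⟩

/-- A type with a membership relation as a first-order structure. -/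
instance setStructure (M : Type u) [Membership M M] : setLang.Structure M where
  funMap := fun f => f.elim
  RelMap := fun r v => match r, v with
    | .mem, v => v 0 ∈ v 1

variable {M : Type u} [Membership M M]

/-- `e = ∅`. -/
def IsEmptySet (e : M) : Prop := ∀ x : M, x ∉ e

/-- `m = n ∪ {n}`. -/
def IsSucc (n m : M) : Prop := ∀ x : M, x ∈ m ↔ x ∈ n ∨ x = n

/-- `w` contains `∅` and is closed under `n ↦ n ∪ {n}`. -/
def IsInductive (w : M) : Prop :=
  (∃ e : M, IsEmptySet e ∧ e ∈ w) ∧ ∀ n : M, n ∈ w → ∃ m : M, IsSucc n m ∧ m ∈ w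

/-- `w = ω`, the least inductive set of the model. -/
def IsOmega (w : M) : Prop :=
  IsInductive w ∧ ∀ v : M, IsInductive v → ∀ n : M, n ∈ w → n ∈ v

/-- `p = (x, y) = {{x}, {x, y}}`. -/
def IsPair (p x y : M) : Prop :=
  ∀ u : M, u ∈ p ↔ (∀ v : M, v ∈ u ↔ v = x) ∨ (∀ v : M, v ∈ u ↔ v = x ∨ v = y)

/-- The type of elements of the set `a` of the model. -/
def El (a : M) : Type u := {x : M // x ∈ a}

/-- The set of the model underlying an element of `a`. -/
def El.val {a : M} (x : El a) : M := Subtype.val x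

/-- The subcollection of `a` cut out by the set `s` of the model. -/
def ext (a s : M) : Set (El a) := {x | x.val ∈ s}

/-- `S` is (the extension of) a set of the model. -/
def Internal {a : M} (S : Set (El a)) : Prop := ∃ s : M, S = ext a s

/-- The binary relation `r` between `a` and `b` is a set of ordered pairs of the model. -/
def InternalRel {a b : M} (r : El a → El b → Prop) : Prop :=
  ∃ s : M, ∀ (x : El a) (y : El b), r x y ↔ ∃ p : M, IsPair p x.val y.val ∧ p ∈ s

/-- The function `f : a → b` belongs to the model. -/
def InternalFun {a b : M} (f : El a → El b) : Prop := InternalRel fun x y => f x = y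

/-- The function `f : a × b → c` belongs to the model (as a set of pairs `((x, y), z)`). -/
def InternalFun₂ {a b c : M} (f : El a → El b → El c) : Prop :=
  ∃ s : M, ∀ (x : El a) (y : El b) (z : El c), f x y = z ↔
    ∃ q p : M, IsPair q x.val y.val ∧ IsPair p q z.val ∧ p ∈ s

variable (M) in
/-- `M` is a model of Zermelo–Fraenkel set theory (without choice) together with the axiom of
dependent choice.  The two schemas range over all first-order formulas in the language of set
theory with parameters from `M`. -/
structure IsModelZFDC : Prop where
  extensionality : ∀ x y : M, (∀ z : M, z ∈ x ↔ z ∈ y) → x = y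
  foundation : ∀ x : M, (∃ y : M, y ∈ x) → ∃ y : M, y ∈ x ∧ ∀ z : M, z ∈ y → z ∉ x
  pairing : ∀ x y : M, ∃ z : M, ∀ v : M, v ∈ z ↔ v = x ∨ v = y
  union : ∀ x : M, ∃ z : M, ∀ v : M, v ∈ z ↔ ∃ y : M, y ∈ x ∧ v ∈ y
  powerset : ∀ x : M, ∃ z : M, ∀ v : M, v ∈ z ↔ ∀ t : M, t ∈ v → t ∈ x
  infinity : ∃ w : M, IsInductive w
  separation : ∀ D : Set M, (Set.univ : Set M).Definable₁ setLang D →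
    ∀ x : M, ∃ z : M, ∀ v : M, v ∈ z ↔ v ∈ x ∧ v ∈ D
  replacement : ∀ D : Set (M × M), (Set.univ : Set M).Definable₂ setLang D →
    ∀ x : M, (∀ v : M, v ∈ x → ∃! t : M, (v, t) ∈ D) →
      ∃ z : M, ∀ t : M, t ∈ z ↔ ∃ v : M, v ∈ x ∧ (v, t) ∈ D
  dependentChoice : ∀ ω : M, IsOmega ω → ∀ (X : M) (r : El X → El X → Prop), InternalRel r →
    Nonempty (El X) → (∀ x : El X, ∃ y : El X, r x y) →
      ∃ f : El ω → El X, InternalFun f ∧ ∀ n m : El ω, IsSucc n.val m.val → r (f n) (f m)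

/-! ## Cardinality inside the model -/

/-- `a` is countable (finite or countably infinite) in the model: it injects into `ω`. -/
def IsCountable (ω a : M) : Prop :=
  ∃ f : El a → El ω, InternalFun f ∧ Function.Injective f

/-- `a` is finite in the model: it is equinumerous with some `n ∈ ω`. -/
def IsFinite (ω a : M) : Prop :=
  ∃ n : M, n ∈ ω ∧ ∃ f : El a → El n, InternalFun f ∧ Function.Bijective f

/-! ## The real line of the model and Vitali sets -/

/-- `R`, with its given operations and order, is the real line of the model: its unique (up to
unique isomorphism) complete ordered field.  The operations and the order are sets of the model,
and suprema exist for those non-empty bounded subsets that are sets of the model. -/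
structure IsRealLine (R : M) [Field (El R)] [LinearOrder (El R)] : Prop where
  orderedField : IsStrictOrderedRing (El R)
  add_internal : InternalFun₂ fun x y : El R => x + y
  mul_internal : InternalFun₂ fun x y : El R => x * y
  le_internal : InternalRel fun x y : El R => x ≤ y
  complete : ∀ S : Set (El R), Internal S → S.Nonempty → BddAbove S → ∃ b, IsLUB S b

/-- `x` is a rational number of the model: it lies in the smallest subfield of `R` in the model. -/
def IsRational {R : M} [Field (El R)] (x : El R) : Prop :=
  ∀ K : Subfield (El R), Internal (K : Set (El R)) → x ∈ K

/-- `T` is a Vitali set: a subset of `R` meeting every translate `x + ℚ` in exactly one point. -/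
def IsVitaliSet (R : M) [Field (El R)] (T : M) : Prop :=
  (∀ t : M, t ∈ T → t ∈ R) ∧ ∀ x : El R, ∃! t : El R, t.val ∈ T ∧ IsRational (t - x)

/-! ## Polish groups of the model -/

section Polish

variable (ω R : M) [Field (El R)] [LinearOrder (El R)]

/-- `d` is a metric on `X`, in the model. -/
structure IsMetric {X : M} (d : El X → El X → El R) : Prop where
  internal : InternalFun₂ d
  eq_zero_iff : ∀ x y, d x y = 0 ↔ x = y
  symm : ∀ x y, d x y = d y x
  triangle : ∀ x y z, d x z ≤ d x y + d y z

/-- Every Cauchy sequence of the model converges.  On `ω` the relation `m < n` is `m ∈ n`. -/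
def IsCompleteMetric {X : M} (d : El X → El X → El R) : Prop :=
  ∀ s : El ω → El X, InternalFun s →
    (∀ ε : El R, 0 < ε → ∃ N : El ω, ∀ m n : El ω,
      N.val ∈ m.val → N.val ∈ n.val → d (s m) (s n) < ε) →
    ∃ x : El X, ∀ ε : El R, 0 < ε → ∃ N : El ω, ∀ n : El ω, N.val ∈ n.val → d (s n) x < ε

/-- There is a countable dense subset, in the model. -/
def IsSeparableMetric {X : M} (d : El X → El X → El R) : Prop :=
  ∃ D : M, (∀ x : M, x ∈ D → x ∈ X) ∧ IsCountable ω D ∧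
    ∀ (x : El X) (ε : El R), 0 < ε → ∃ y : El X, y.val ∈ D ∧ d x y < ε

/-- `τ` is the set of all open subsets of `X` for the metric `d`, where all subsets are sets of the
model. -/
def IsMetricTopology {X : M} (τ : M) (d : El X → El X → El R) : Prop :=
  ∀ U : M, U ∈ τ ↔ (∀ x : M, x ∈ U → x ∈ X) ∧
    ∀ x : El X, x.val ∈ U → ∃ ε : El R, 0 < ε ∧ ∀ y : El X, d x y < ε → y.val ∈ U

/-- `G`, with its given multiplication and with the set `τ` of its open subsets, is a Polish group
of the model: a topological group whose topology is separable and completely metrizable. -/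
structure IsPolishGroup (G τ : M) [Group (El G)] : Prop where
  mul_internal : InternalFun₂ fun x y : El G => x * y
  polish : ∃ d : El G → El G → El R, IsMetric R d ∧ IsCompleteMetric ω R d ∧
    IsSeparableMetric ω R d ∧ IsMetricTopology R τ d
  continuous_mul : ∀ (x y : El G) (U : M), U ∈ τ → (x * y).val ∈ U →
    ∃ V W : M, V ∈ τ ∧ W ∈ τ ∧ x.val ∈ V ∧ y.val ∈ W ∧
      ∀ a b : El G, a.val ∈ V → b.val ∈ W → (a * b).val ∈ U
  continuous_inv : ∀ (x : El G) (U : M), U ∈ τ → (x⁻¹).val ∈ U →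
    ∃ V : M, V ∈ τ ∧ x.val ∈ V ∧ ∀ a : El G, a.val ∈ V → (a⁻¹).val ∈ U

end Polish

/-- `C` is the set `{gF : g ∈ K}` of left cosets of `F` in `K`. -/
def IsCosetSpace {G : M} [Group (El G)] (K F : Subgroup (El G)) (C : M) : Prop :=
  ∀ c : M, c ∈ C ↔
    ∃ g : El G, g ∈ K ∧ ∀ x : M, x ∈ c ↔ ∃ f : El G, f ∈ F ∧ (g * f).val = x

end SetModel

/-! The group `G₀` is the closure `H` of `F`, which contains `F` and is normal when `F` is. It is
open by Baire category: otherwise each coset of `H` is closed with empty interior, and countably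
many of them cannot cover the group (`isOpen_topologicalClosure`). The substance is that `F` has
finite index in `H`; if not, a Vitali set is built (`exists_vitali`).

Suppose that finitely many cosets of `F` never cover `H`. Density of `F` in `H` then yields elements
of `H` arbitrarily close to `1` that move a given finite set off finitely many cosets
(`exists_displacement`). A real `x` is encoded by its factorial digits, that is, by the sets where
the fractional part of `n! x` is below `j / (n + 1)` (`Digit`). Reals with rational difference have
the same digits from some place on (`digit_iff_of_isRat_sub`), and the digits separate the points of
`[0, 1)` (`eq_of_digit_iff`).

Starting from the constant `1`, maps `p n` from the reals to `H` with finite range are built: `p (n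
+ 1)` arises from `p n` by multiplying on the left by a tiny element over each `n`-th digit set in
turn (`exists_split`). The quotient `(p n x)⁻¹ * p n y` is unchanged at step `n` if the `n`-th
digits of `x` and `y` agree; after the step it can be in `F` only if these digits agree and it was
in `F` before. The maps converge uniformly to some `φ`. If `x - y` is rational, `(φ x)⁻¹ * φ y`
equals the quotient at every late stage; if it is in `F`, all digits agree, so `x = y` when both lie
in `[0, 1)`. Hence `φ` sends the points of `x + ℚ` in `[0, 1)` to distinct cosets of `F`. As the
cosets inject into `ω`, the point of least index can be selected without choice.

All of this must take place inside `M`, whose `ω` may be nonstandard. The objects used are therefore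
those definable with parameters: separation makes every definable part of a set an element of `M`,
and induction is available for definable predicates only. `Coded` and `Small` types carry this
bookkeeping. Dependent choice supplies the sequences. -/

namespace SetModel

universe u

set_option linter.unusedSectionVars false

section

variable {M : Type u} [Membership M M]

/-! ## Definability with parameters -/

/-- A property of assignments `ℕ → M` that is first-order definable with parameters. -/
def RawDef (Q : (ℕ → M) → Prop) : Prop :=
  (Set.univ : Set M).Definable setLang {v : ℕ → M | Q v}

namespace RawDef

variable {P Q : (ℕ → M) → Prop}

theorem congr (h : RawDef P) (e : ∀ v, Q v ↔ P v) : RawDef Q := by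
  have : Q = P := funext fun v => propext (e v)
  rwa [this]

theorem and (hP : RawDef P) (hQ : RawDef Q) : RawDef fun v => P v ∧ Q v :=
  Set.Definable.inter hP hQ

theorem or (hP : RawDef P) (hQ : RawDef Q) : RawDef fun v => P v ∨ Q v :=
  Set.Definable.union hP hQ

theorem not (hP : RawDef P) : RawDef fun v => ¬ P v :=
  Set.Definable.compl hP

theorem imp (hP : RawDef P) (hQ : RawDef Q) : RawDef fun v => P v → Q v :=
  (hP.not.or hQ).congr fun _ => imp_iff_not_or

theorem iff (hP : RawDef P) (hQ : RawDef Q) : RawDef fun v => P v ↔ Q v :=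
  ((hP.imp hQ).and (hQ.imp hP)).congr fun _ => iff_iff_implies_and_implies

theorem reindex (f : ℕ → ℕ) (hQ : RawDef Q) : RawDef fun v => Q fun n => v (f n) :=
  Set.Definable.preimage_comp f hQ

/-- Variables are numbered in de Bruijn style: `v 0` is the bound variable and the free ones are
shifted by one. -/
theorem ex {Q : M → (ℕ → M) → Prop} (h : RawDef fun v => Q (v 0) fun n => v (n + 1)) :
    RawDef fun v => ∃ x, Q x v := by
  let f : ℕ → ℕ ⊕ Fin 1 := fun n => n.casesOn (Sum.inr 0) Sum.inl
  refine (congrArg (Set.Definable _ _) ?_).mp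
    (Set.Definable.image_comp_sumInl_fin 1 (Set.Definable.preimage_comp f h))
  ext v
  constructor
  · rintro ⟨w, hw, rfl⟩
    exact ⟨w (Sum.inr 0), hw⟩
  · rintro ⟨x, hx⟩
    exact ⟨Sum.elim v fun _ => x, hx, rfl⟩

theorem all {Q : M → (ℕ → M) → Prop} (h : RawDef fun v => Q (v 0) fun n => v (n + 1)) :
    RawDef fun v => ∀ x, Q x v :=
  (ex (Q := fun x v => ¬ Q x v) h.not).not.congr fun v => by simp

/-- Variables and constants. -/
def Term (t : (ℕ → M) → M) : Prop :=
  ∃ τ : (setLang.withConstants (Set.univ : Set M)).Term ℕ, ∀ v, τ.realize v = t v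

theorem Term.var (i : ℕ) : Term fun v : ℕ → M => v i :=
  ⟨FirstOrder.Language.Term.var i, fun _ => rfl⟩

theorem Term.const (c : M) : Term fun _ : ℕ → M => c :=
  ⟨FirstOrder.Language.Constants.term
    (setLang.con (⟨c, Set.mem_univ c⟩ : (Set.univ : Set M))), fun v => by simp⟩

theorem mem {s t : (ℕ → M) → M} (hs : Term s) (ht : Term t) : RawDef fun v => s v ∈ t v := by
  obtain ⟨σ, hσ⟩ := hs
  obtain ⟨τ, hτ⟩ := ht
  let r : (setLang.withConstants (Set.univ : Set M)).Relations 2 := Sum.inl MemRel.mem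
  refine ⟨r.formula₂ σ τ, ?_⟩
  ext v
  have h1 : FirstOrder.Language.Structure.RelMap r ![σ.realize v, τ.realize v] ↔
      σ.realize v ∈ τ.realize v := Iff.rfl
  change s v ∈ t v ↔ (r.formula₂ σ τ).Realize v
  rw [FirstOrder.Language.Formula.realize_rel₂, h1, hσ, hτ]

theorem eq {s t : (ℕ → M) → M} (hs : Term s) (ht : Term t) : RawDef fun v => s v = t v := by
  obtain ⟨σ, hσ⟩ := hs
  obtain ⟨τ, hτ⟩ := ht
  refine ⟨σ.equal τ, ?_⟩
  ext v
  change s v = t v ↔ (σ.equal τ).Realize v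
  rw [FirstOrder.Language.Formula.realize_equal, hσ, hτ]

/-- A proposition without variables is simply true or false, so even one that refers to things
outside `M` is definable. -/
theorem const (p : Prop) : RawDef fun _ : ℕ → M => p := by
  by_cases hp : p
  · exact (eq (Term.var 0) (Term.var 0)).congr fun v => by simp [hp]
  · exact (eq (Term.var 0) (Term.var 0)).not.congr fun v => by simp [hp]

theorem isPair (i j k : ℕ) : RawDef fun v : ℕ → M => IsPair (v i) (v j) (v k) := by
  unfold IsPair
  refine all ?_
  refine iff (mem (Term.var _) (Term.var _)) (or (all ?_) (all ?_))
  · exact iff (mem (Term.var _) (Term.var _)) (eq (Term.var _) (Term.var _))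
  · exact iff (mem (Term.var _) (Term.var _))
      (or (eq (Term.var _) (Term.var _)) (eq (Term.var _) (Term.var _)))

theorem definable₁ {D : Set M} (h : RawDef fun v => v 0 ∈ D) :
    (Set.univ : Set M).Definable₁ setLang D :=
  Set.Definable.preimage_comp (fun _ => (0 : Fin 1)) h

end RawDef

/-! ## Ordered pairs -/

/-- `M` is a model of ZF + DC, as a typeclass. -/
class ZFDC (M : Type u) [Membership M M] : Prop where
  isModel : IsModelZFDC M

variable [ZFDC M]

theorem ext_of_mem {x y : M} (h : ∀ z : M, z ∈ x ↔ z ∈ y) : x = y :=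
  ZFDC.isModel.extensionality x y h

theorem exists_isPair (x y : M) : ∃ p : M, IsPair p x y := by
  obtain ⟨a, ha⟩ := ZFDC.isModel.pairing x x
  obtain ⟨b, hb⟩ := ZFDC.isModel.pairing x y
  obtain ⟨p, hp⟩ := ZFDC.isModel.pairing a b
  refine ⟨p, fun u => ?_⟩
  rw [hp]
  refine or_congr ⟨?_, fun h => ext_of_mem fun v => ?_⟩ ⟨?_, fun h => ext_of_mem fun v => ?_⟩
  · rintro rfl v
    simpa using ha v
  · rw [h, ha, or_self]
  · rintro rfl v
    exact hb v
  · rw [h, hb]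

/-- The ordered pair of the model. -/
noncomputable def pair (x y : M) : M := (exists_isPair x y).choose

theorem isPair_pair (x y : M) : IsPair (pair x y) x y := (exists_isPair x y).choose_spec

theorem isPair_iff {p x y : M} : IsPair p x y ↔ p = pair x y := by
  constructor
  · intro h
    exact ext_of_mem fun z => (h z).trans (isPair_pair x y z).symm
  · rintro rfl
    exact isPair_pair x y

theorem pair_inj {x y x' y' : M} (h : pair x y = pair x' y') : x = x' ∧ y = y' := by
  have h1 : IsPair (pair x y) x' y' := h ▸ isPair_pair x' y'
  obtain ⟨a, ha⟩ := ZFDC.isModel.pairing x x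
  obtain ⟨b, hb⟩ := ZFDC.isModel.pairing x y
  obtain ⟨b', hb'⟩ := ZFDC.isModel.pairing x' y'
  have hx : x = x' := by
    have hm : a ∈ pair x y := (isPair_pair x y a).2 (Or.inl fun v => by simp [ha])
    rcases (h1 a).1 hm with h | h
    · exact (h x).1 ((ha x).2 (Or.inl rfl))
    · have := (ha x').1 ((h x').2 (Or.inl rfl))
      simpa [eq_comm] using this
  subst hx
  refine ⟨rfl, ?_⟩
  have e1 : y = x ∨ y = y' := by
    rcases (h1 b).1 ((isPair_pair x y b).2 (Or.inr hb)) with h | h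
    · exact Or.inl ((h y).1 ((hb y).2 (Or.inr rfl)))
    · exact (h y).1 ((hb y).2 (Or.inr rfl))
  have e2 : y' = x ∨ y' = y := by
    rcases (isPair_pair x y b').1 ((h1 b').2 (Or.inr hb')) with h | h
    · exact Or.inl ((h y').1 ((hb' y').2 (Or.inr rfl)))
    · exact (h y').1 ((hb' y').2 (Or.inr rfl))
  rcases e1 with rfl | rfl
  · rcases e2 with rfl | rfl <;> rfl
  · rfl

theorem RawDef.eq_pair (i j k : ℕ) : RawDef fun v : ℕ → M => v i = pair (v j) (v k) :=
  (RawDef.isPair i j k).congr fun _ => isPair_iff.symm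

/-! ## Coded types -/

variable (M) in
/-- A type whose elements are coded, injectively, by the elements of a definable class of `M`. -/
class Coded (X : Type u) where
  code : X → M
  code_injective : Function.Injective code
  rawDef_range : RawDef fun v : ℕ → M => ∃ x, code x = v 0

open Coded

variable (M) in
/-- A predicate on a coded type that is definable with parameters. -/
def Dfn {X : Type u} [Coded M X] (P : X → Prop) : Prop :=
  RawDef fun v : ℕ → M => ∃ x, code x = v 0 ∧ P x

noncomputable instance : Coded M M where
  code := id
  code_injective := Function.injective_id
  rawDef_range := (RawDef.const True).congr fun v => by simp

noncomputable instance {X Y : Type u} [Coded M X] [Coded M Y] : Coded M (X × Y) where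
  code := fun p => pair (code p.1) (code p.2)
  code_injective := fun p q h => Prod.ext (code_injective (pair_inj h).1)
    (code_injective (pair_inj h).2)
  rawDef_range := by
    refine RawDef.congr (RawDef.ex (Q := fun m v => ∃ n, v 0 = pair m n ∧
      (∃ x : X, code x = m) ∧ ∃ y : Y, code y = n) (RawDef.ex (Q := fun n v => v 1 = pair (v 0) n ∧
      (∃ x : X, code x = v 0) ∧ ∃ y : Y, code y = n) ?_)) fun v => ?_
    · exact (RawDef.eq_pair _ _ _).and (((rawDef_range (M := M) (X := X)).reindex fun _ => 1).and
        (rawDef_range (M := M) (X := Y)))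
    · constructor
      · rintro ⟨p, hp⟩
        exact ⟨_, _, hp.symm, ⟨_, rfl⟩, ⟨_, rfl⟩⟩
      · rintro ⟨_, _, hp, ⟨x, rfl⟩, ⟨y, rfl⟩⟩
        exact ⟨(x, y), hp.symm⟩

variable (M) in
/-- A function between coded types whose graph is definable with parameters. -/
def DfnF {X Y : Type u} [Coded M X] [Coded M Y] (f : X → Y) : Prop :=
  Dfn M fun p : X × Y => f p.1 = p.2

section

variable {X Y Z : Type u} [Coded M X] [Coded M Y] [Coded M Z]

/-! ### Closure of definability under logical operations and composition -/

theorem code_pair (x : X) (y : Y) : (code (x, y) : M) = pair (code x) (code y) := rfl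

theorem Dfn.congr {P Q : X → Prop} (h : Dfn M P) (e : ∀ x, Q x ↔ P x) : Dfn M Q := by
  have : Q = P := funext fun v => propext (e v)
  rwa [this]

theorem Dfn.raw {P : X → Prop} (h : Dfn M P) (i : ℕ) :
    RawDef fun v : ℕ → M => ∃ x, code x = v i ∧ P x :=
  h.reindex fun _ => i

theorem Dfn.and {P Q : X → Prop} (hP : Dfn M P) (hQ : Dfn M Q) : Dfn M fun x => P x ∧ Q x := by
  refine (RawDef.and hP hQ).congr fun v => ⟨?_, ?_⟩
  · rintro ⟨x, h, h1, h2⟩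
    exact ⟨⟨x, h, h1⟩, x, h, h2⟩
  · rintro ⟨⟨x, h, h1⟩, y, h', h2⟩
    obtain rfl : x = y := code_injective (h.trans h'.symm)
    exact ⟨x, h, h1, h2⟩

theorem Dfn.not {P : X → Prop} (hP : Dfn M P) : Dfn M fun x => ¬ P x := by
  refine (RawDef.and (rawDef_range (M := M) (X := X)) (RawDef.not hP)).congr fun v => ⟨?_, ?_⟩
  · rintro ⟨x, h, h1⟩
    refine ⟨⟨x, h⟩, ?_⟩
    rintro ⟨y, h', h2⟩
    obtain rfl : x = y := code_injective (h.trans h'.symm)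
    exact h1 h2
  · rintro ⟨⟨x, h⟩, h1⟩
    exact ⟨x, h, fun h2 => h1 ⟨x, h, h2⟩⟩

theorem Dfn.or {P Q : X → Prop} (hP : Dfn M P) (hQ : Dfn M Q) : Dfn M fun x => P x ∨ Q x :=
  (hP.not.and hQ.not).not.congr fun _ => by tauto

theorem Dfn.imp {P Q : X → Prop} (hP : Dfn M P) (hQ : Dfn M Q) : Dfn M fun x => P x → Q x :=
  (hP.and hQ.not).not.congr fun _ => by tauto

theorem Dfn.iff {P Q : X → Prop} (hP : Dfn M P) (hQ : Dfn M Q) : Dfn M fun x => P x ↔ Q x :=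
  ((hP.imp hQ).and (hQ.imp hP)).congr fun _ => iff_iff_implies_and_implies

theorem Dfn.const (p : Prop) : Dfn M fun _ : X => p :=
  ((rawDef_range (M := M) (X := X)).and (RawDef.const p)).congr fun v => by simp

/-- Quantifying over `Y` becomes quantifying over all of `M`: whether an element of `M` codes a
suitable `y` is read off from the pair that it forms with the code of `x`. -/
theorem Dfn.ex {P : X → Y → Prop} (h : Dfn M fun p : X × Y => P p.1 p.2) :
    Dfn M fun x => ∃ y, P x y := by
  refine RawDef.congr (RawDef.and (rawDef_range (M := M) (X := X)) (RawDef.ex (Q := fun m v => ∃ q,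
    q = pair (v 0) m ∧ ∃ p : X × Y, code p = q ∧ P p.1 p.2) (RawDef.ex (Q := fun q v =>
    q = pair (v 1) (v 0) ∧ ∃ p : X × Y, code p = q ∧ P p.1 p.2) ?_))) fun v => ⟨?_, ?_⟩
  · exact (RawDef.eq_pair _ _ _).and h
  · rintro ⟨x, hx, y, hy⟩
    exact ⟨⟨x, hx⟩, code y, _, rfl, (x, y), by rw [code_pair, hx], hy⟩
  · rintro ⟨⟨x, hx⟩, m, _, rfl, ⟨x', y⟩, hp, h⟩
    obtain ⟨h1, h2⟩ := pair_inj hp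
    exact ⟨x', h1, y, h⟩

theorem Dfn.all {P : X → Y → Prop} (h : Dfn M fun p : X × Y => P p.1 p.2) :
    Dfn M fun x => ∀ y, P x y :=
  (Dfn.ex (P := fun x y => ¬ P x y) h.not).not.congr fun v => by simp

theorem Dfn.comp {P : Y → Prop} {f : X → Y} (hP : Dfn M P) (hf : DfnF M f) :
    Dfn M fun x => P (f x) := by
  refine RawDef.congr (RawDef.ex (Q := fun m v => (∃ y, code y = m ∧ P y) ∧ ∃ q,
    q = pair (v 0) m ∧ ∃ p : X × Y, code p = q ∧ f p.1 = p.2) (RawDef.and hP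
    (RawDef.ex (Q := fun q v => q = pair (v 1) (v 0) ∧ ∃ p : X × Y, code p = q ∧ f p.1 = p.2) ?_)))
    fun v => ⟨?_, ?_⟩
  · exact (RawDef.eq_pair _ _ _).and hf
  · rintro ⟨x, hx, hy⟩
    exact ⟨code (f x), ⟨_, rfl, hy⟩, _, rfl, (x, f x), by rw [code_pair, hx], rfl⟩
  · rintro ⟨_, ⟨y, rfl, hy⟩, _, rfl, ⟨x', y⟩, hp, h⟩
    obtain ⟨h1, h2⟩ := pair_inj hp
    obtain rfl := code_injective h2
    obtain rfl : f x' = y := h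
    exact ⟨x', h1, hy⟩

theorem DfnF.congr {f g : X → Y} (h : DfnF M f) (e : ∀ x, g x = f x) : DfnF M g := by
  rwa [funext e]

theorem Dfn.eq₀ : Dfn M fun p : X × X => p.1 = p.2 := by
  refine RawDef.congr (RawDef.ex (Q := fun m v => (∃ x : X, code x = m) ∧ v 0 = pair m m)
    ((rawDef_range (M := M) (X := X)).and (RawDef.eq_pair 1 0 0))) fun v => ⟨?_, ?_⟩
  · rintro ⟨⟨x, y⟩, h, h'⟩
    obtain rfl : x = y := h'
    exact ⟨code x, ⟨x, rfl⟩, h.symm⟩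
  · rintro ⟨_, ⟨x, rfl⟩, h⟩
    exact ⟨(x, x), h.symm, rfl⟩

theorem DfnF.id : DfnF M fun x : X => x := Dfn.eq₀

theorem DfnF.fst₀ : DfnF M fun p : X × Y => p.1 := by
  refine RawDef.congr (RawDef.ex (Q := fun m v => ∃ n q, (∃ x : X, code x = m) ∧
    (∃ y : Y, code y = n) ∧ q = pair m n ∧ v 0 = pair q m) (RawDef.ex (Q := fun n v => ∃ q,
    (∃ x : X, code x = v 0) ∧
    (∃ y : Y, code y = n) ∧ q = pair (v 0) n ∧ v 1 = pair q (v 0)) (RawDef.ex (Q := fun q v =>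
    (∃ x : X, code x = v 1) ∧
    (∃ y : Y, code y = v 0) ∧ q = pair (v 1) (v 0) ∧ v 2 = pair q (v 1)) ?_)))
    fun v => ⟨?_, ?_⟩
  · exact ((rawDef_range (M := M) (X := X)).reindex fun _ => 2).and
      (((rawDef_range (M := M) (X := Y)).reindex fun _ => 1).and
      ((RawDef.eq_pair _ _ _).and (RawDef.eq_pair _ _ _)))
  · rintro ⟨⟨⟨x, y⟩, x'⟩, h, h'⟩
    obtain rfl : x = x' := h'
    exact ⟨code x, code y, _, ⟨x, rfl⟩, ⟨y, rfl⟩, rfl, h.symm⟩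
  · rintro ⟨_, _, _, ⟨x, rfl⟩, ⟨y, rfl⟩, rfl, h⟩
    exact ⟨((x, y), x), h.symm, rfl⟩

theorem DfnF.snd₀ : DfnF M fun p : X × Y => p.2 := by
  refine RawDef.congr (RawDef.ex (Q := fun m v => ∃ n q, (∃ x : X, code x = m) ∧
    (∃ y : Y, code y = n) ∧ q = pair m n ∧ v 0 = pair q n) (RawDef.ex (Q := fun n v => ∃ q,
    (∃ x : X, code x = v 0) ∧
    (∃ y : Y, code y = n) ∧ q = pair (v 0) n ∧ v 1 = pair q n) (RawDef.ex (Q := fun q v =>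
    (∃ x : X, code x = v 1) ∧
    (∃ y : Y, code y = v 0) ∧ q = pair (v 1) (v 0) ∧ v 2 = pair q (v 0)) ?_)))
    fun v => ⟨?_, ?_⟩
  · exact ((rawDef_range (M := M) (X := X)).reindex fun _ => 2).and
      (((rawDef_range (M := M) (X := Y)).reindex fun _ => 1).and
      ((RawDef.eq_pair _ _ _).and (RawDef.eq_pair _ _ _)))
  · rintro ⟨⟨⟨x, y⟩, x'⟩, h, h'⟩
    obtain rfl : y = x' := h'
    exact ⟨code x, code y, _, ⟨x, rfl⟩, ⟨y, rfl⟩, rfl, h.symm⟩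
  · rintro ⟨_, _, _, ⟨x, rfl⟩, ⟨y, rfl⟩, rfl, h⟩
    exact ⟨((x, y), y), h.symm, rfl⟩

theorem DfnF.const (c : Y) : DfnF M fun _ : X => c := by
  refine RawDef.congr (RawDef.ex (Q := fun m v => ∃ n, (∃ x : X, code x = m) ∧
    n = code c ∧ v 0 = pair m n) (RawDef.ex (Q := fun n v =>
    (∃ x : X, code x = v 0) ∧ n = code c ∧ v 1 = pair (v 0) n) ?_))
    fun v => ⟨?_, ?_⟩
  · exact ((rawDef_range (M := M) (X := X)).reindex fun _ => 1).and
      ((RawDef.eq (RawDef.Term.var _) (RawDef.Term.const _)).and (RawDef.eq_pair _ _ _))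
  · rintro ⟨⟨x, y⟩, h, h'⟩
    obtain rfl : c = y := h'
    exact ⟨code x, _, ⟨x, rfl⟩, rfl, h.symm⟩
  · rintro ⟨_, _, ⟨x, rfl⟩, rfl, h⟩
    exact ⟨(x, c), h.symm, rfl⟩

theorem DfnF.code₀ : DfnF M fun x : X => (code x : M) := by
  refine RawDef.congr (RawDef.ex (Q := fun m v => (∃ x : X, code x = m) ∧ v 0 = pair m m)
    ((rawDef_range (M := M) (X := X)).and (RawDef.eq_pair 1 0 0))) fun v => ⟨?_, ?_⟩
  · rintro ⟨⟨x, y⟩, h, h'⟩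
    obtain rfl : code x = y := h'
    exact ⟨code x, ⟨x, rfl⟩, h.symm⟩
  · rintro ⟨_, ⟨x, rfl⟩, h⟩
    exact ⟨(x, code x), h.symm, rfl⟩

theorem DfnF.prodMk {f : Z → X} {g : Z → Y} (hf : DfnF M f) (hg : DfnF M g) :
    DfnF M fun z => (f z, g z) := by
  refine RawDef.congr (RawDef.ex (Q := fun c v => ∃ a b d e h, (∃ p : Z × X, code p = d ∧ f p.1 = p.2) ∧
    (∃ p : Z × Y, code p = e ∧ g p.1 = p.2) ∧ d = pair c a ∧ e = pair c b ∧ h = pair a b ∧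
    v 0 = pair c h)
    (RawDef.ex (Q := fun a v => ∃ b d e h, (∃ p : Z × X, code p = d ∧ f p.1 = p.2) ∧
    (∃ p : Z × Y, code p = e ∧ g p.1 = p.2) ∧ d = pair (v 0) a ∧ e = pair (v 0) b ∧ h = pair a b ∧
    v 1 = pair (v 0) h)
    (RawDef.ex (Q := fun b v => ∃ d e h, (∃ p : Z × X, code p = d ∧ f p.1 = p.2) ∧
    (∃ p : Z × Y, code p = e ∧ g p.1 = p.2) ∧ d = pair (v 1) (v 0) ∧ e = pair (v 1) b ∧
    h = pair (v 0) b ∧ v 2 = pair (v 1) h)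
    (RawDef.ex (Q := fun d v => ∃ e h, (∃ p : Z × X, code p = d ∧ f p.1 = p.2) ∧
    (∃ p : Z × Y, code p = e ∧ g p.1 = p.2) ∧ d = pair (v 2) (v 1) ∧ e = pair (v 2) (v 0) ∧
    h = pair (v 1) (v 0) ∧ v 3 = pair (v 2) h)
    (RawDef.ex (Q := fun e v => ∃ h, (∃ p : Z × X, code p = v 0 ∧ f p.1 = p.2) ∧
    (∃ p : Z × Y, code p = e ∧ g p.1 = p.2) ∧ v 0 = pair (v 3) (v 2) ∧ e = pair (v 3) (v 1) ∧
    h = pair (v 2) (v 1) ∧ v 4 = pair (v 3) h)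
    (RawDef.ex (Q := fun h v => (∃ p : Z × X, code p = v 1 ∧ f p.1 = p.2) ∧
    (∃ p : Z × Y, code p = v 0 ∧ g p.1 = p.2) ∧ v 1 = pair (v 4) (v 3) ∧ v 0 = pair (v 4) (v 2) ∧
    h = pair (v 3) (v 2) ∧ v 5 = pair (v 4) h) ?_))))))
    fun v => ⟨?_, ?_⟩
  · exact (hf.raw _).and ((hg.raw _).and ((RawDef.eq_pair _ _ _).and ((RawDef.eq_pair _ _ _).and
      ((RawDef.eq_pair _ _ _).and (RawDef.eq_pair _ _ _)))))
  · rintro ⟨⟨z, p⟩, h, h'⟩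
    obtain rfl : (f z, g z) = p := h'
    exact ⟨code z, code (f z), code (g z), _, _, _, ⟨(z, f z), rfl, rfl⟩, ⟨(z, g z), rfl, rfl⟩,
      rfl, rfl, rfl, h.symm⟩
  · rintro ⟨_, _, _, _, _, _, ⟨⟨z, x⟩, rfl, hx⟩, ⟨⟨z', y⟩, rfl, hy⟩, h1, h2, rfl, h⟩
    obtain ⟨rfl, rfl⟩ := pair_inj h1
    obtain ⟨h3, rfl⟩ := pair_inj h2
    obtain rfl := code_injective h3
    exact ⟨(z', x, y), h.symm, Prod.ext hx hy⟩

theorem Dfn.eq {f g : Z → X} (hf : DfnF M f) (hg : DfnF M g) : Dfn M fun z => f z = g z :=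
  Dfn.eq₀.comp (hf.prodMk hg)

theorem DfnF.comp {g : X → Y} {f : Z → X} (hg : DfnF M g) (hf : DfnF M f) :
    DfnF M fun z => g (f z) := by
  refine RawDef.congr (RawDef.ex (Q := fun a v => ∃ b c d e, (∃ p : Z × X, code p = d ∧ f p.1 = p.2) ∧
    (∃ p : X × Y, code p = e ∧ g p.1 = p.2) ∧ d = pair a b ∧ e = pair b c ∧ v 0 = pair a c)
    (RawDef.ex (Q := fun b v => ∃ c d e, (∃ p : Z × X, code p = d ∧ f p.1 = p.2) ∧
    (∃ p : X × Y, code p = e ∧ g p.1 = p.2) ∧ d = pair (v 0) b ∧ e = pair b c ∧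
    v 1 = pair (v 0) c)
    (RawDef.ex (Q := fun c v => ∃ d e, (∃ p : Z × X, code p = d ∧ f p.1 = p.2) ∧
    (∃ p : X × Y, code p = e ∧ g p.1 = p.2) ∧ d = pair (v 1) (v 0) ∧ e = pair (v 0) c ∧
    v 2 = pair (v 1) c)
    (RawDef.ex (Q := fun d v => ∃ e, (∃ p : Z × X, code p = d ∧ f p.1 = p.2) ∧
    (∃ p : X × Y, code p = e ∧ g p.1 = p.2) ∧ d = pair (v 2) (v 1) ∧ e = pair (v 1) (v 0) ∧
    v 3 = pair (v 2) (v 0))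
    (RawDef.ex (Q := fun e v => (∃ p : Z × X, code p = v 0 ∧ f p.1 = p.2) ∧
    (∃ p : X × Y, code p = e ∧ g p.1 = p.2) ∧ v 0 = pair (v 3) (v 2) ∧ e = pair (v 2) (v 1) ∧
    v 4 = pair (v 3) (v 1)) ?_)))))
    fun v => ⟨?_, ?_⟩
  · exact (hf.raw _).and ((hg.raw _).and ((RawDef.eq_pair _ _ _).and
      ((RawDef.eq_pair _ _ _).and (RawDef.eq_pair _ _ _))))
  · rintro ⟨⟨z, y⟩, h, h'⟩
    obtain rfl : g (f z) = y := h'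
    exact ⟨code z, code (f z), code (g (f z)), _, _, ⟨(z, f z), rfl, rfl⟩,
      ⟨(f z, g (f z)), rfl, rfl⟩, rfl, rfl, h.symm⟩
  · rintro ⟨_, _, _, _, _, ⟨⟨z, x⟩, rfl, hx⟩, ⟨⟨x', y⟩, rfl, hy⟩, h1, h2, h⟩
    obtain ⟨rfl, rfl⟩ := pair_inj h1
    obtain ⟨h3, rfl⟩ := pair_inj h2
    obtain rfl := code_injective h3
    obtain rfl : f z = x' := hx
    exact ⟨(z, y), h.symm, hy⟩

theorem DfnF.fst {f : Z → X × Y} (hf : DfnF M f) : DfnF M fun z => (f z).1 := DfnF.fst₀.comp hf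

theorem DfnF.snd {f : Z → X × Y} (hf : DfnF M f) : DfnF M fun z => (f z).2 := DfnF.snd₀.comp hf

theorem DfnF.code {f : Z → X} (hf : DfnF M f) : DfnF M fun z => (Coded.code (f z) : M) :=
  DfnF.code₀.comp hf

theorem Dfn.comp₂ {P : X → Y → Prop} (h : Dfn M fun p : X × Y => P p.1 p.2) {f : Z → X} {g : Z → Y}
    (hf : DfnF M f) (hg : DfnF M g) : Dfn M fun z => P (f z) (g z) := h.comp (hf.prodMk hg)

theorem DfnF.comp₂ {W : Type u} [Coded M W] {F : X → Y → W} (h : DfnF M fun p : X × Y => F p.1 p.2)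
    {f : Z → X} {g : Z → Y} (hf : DfnF M f) (hg : DfnF M g) : DfnF M fun z => F (f z) (g z) :=
  DfnF.comp h (hf.prodMk hg)

/-- A function with a definable defining property is definable. -/
theorem DfnF.of_unique {f : X → Y} {P : X → Y → Prop} (h : Dfn M fun p : X × Y => P p.1 p.2)
    (hP : ∀ x y, f x = y ↔ P x y) : DfnF M f :=
  h.congr fun p => hP p.1 p.2

theorem Dfn.mem {f g : Z → M} (hf : DfnF M f) (hg : DfnF M g) : Dfn M fun z => f z ∈ g z := by
  refine Dfn.comp₂ (P := fun x y : M => x ∈ y) ?_ hf hg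
  refine RawDef.congr (RawDef.ex (Q := fun a v => ∃ b, a ∈ b ∧ v 0 = pair a b)
    (RawDef.ex (Q := fun b v => v 0 ∈ b ∧ v 1 = pair (v 0) b)
    ((RawDef.mem (RawDef.Term.var _) (RawDef.Term.var _)).and (RawDef.eq_pair _ _ _))))
    fun v => ⟨?_, ?_⟩
  · rintro ⟨⟨x, y⟩, h, h'⟩
    exact ⟨x, y, h', h.symm⟩
  · rintro ⟨x, y, h', h⟩
    exact ⟨(x, y), h.symm, h'⟩

end

/-! ## Replacement and separation for definable predicates -/

theorem Dfn.raw_self {P : M → Prop} (h : Dfn M P) : RawDef fun v : ℕ → M => P (v 0) :=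
  RawDef.congr h fun v => ⟨fun h => ⟨_, rfl, h⟩, by rintro ⟨x, rfl, h⟩; exact h⟩

theorem exists_separation {P : M → Prop} (h : Dfn M P) (a : M) :
    ∃ s : M, ∀ v, v ∈ s ↔ v ∈ a ∧ P v :=
  ZFDC.isModel.separation {v | P v} (RawDef.definable₁ h.raw_self) a

end

section

variable {M : Type u} [Membership M M] [ZFDC M]

open Coded

/-! ## Coded types that are sets of the model -/

variable (M) in
/-- The codes of the elements of `X` form a set of the model. -/
class Small (X : Type u) [Coded M X] : Prop where
  exists_set : ∃ s : M, ∀ m, m ∈ s ↔ ∃ x : X, code x = m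

section

variable {X Y Z : Type u} [Coded M X] [Coded M Y] [Coded M Z]

theorem exists_set_of_dfn [Small M X] {P : X → Prop} (h : Dfn M P) :
    ∃ s : M, ∀ m, m ∈ s ↔ ∃ x : X, code x = m ∧ P x := by
  obtain ⟨a, ha⟩ := Small.exists_set (M := M) (X := X)
  have h' : Dfn M fun m : M => ∃ x : X, code x = m ∧ P x :=
    Dfn.ex ((Dfn.eq DfnF.id.snd.code DfnF.id.fst).and (h.comp DfnF.id.snd))
  obtain ⟨s, hs⟩ := exists_separation h' a
  refine ⟨s, fun m => (hs m).trans ⟨fun h => h.2, fun h => ⟨(ha m).2 ?_, h⟩⟩⟩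
  obtain ⟨x, hx, -⟩ := h
  exact ⟨x, hx⟩

theorem exists_binary_union (a b : M) : ∃ c : M, ∀ x, x ∈ c ↔ x ∈ a ∨ x ∈ b := by
  obtain ⟨p, hp⟩ := ZFDC.isModel.pairing a b
  obtain ⟨c, hc⟩ := ZFDC.isModel.union p
  exact ⟨c, fun x => (hc x).trans (by simp [hp])⟩

/-- Kuratowski pairs of elements of `a` and `b` lie in the double power set of `a ∪ b`, from which
separation cuts out the product. -/
instance [Small M X] [Small M Y] : Small M (X × Y) where
  exists_set := by
    obtain ⟨a, ha⟩ := Small.exists_set (M := M) (X := X)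
    obtain ⟨b, hb⟩ := Small.exists_set (M := M) (X := Y)
    obtain ⟨c, hc⟩ := exists_binary_union a b
    obtain ⟨d, hd⟩ := ZFDC.isModel.powerset c
    obtain ⟨e, he⟩ := ZFDC.isModel.powerset d
    have h : Dfn M fun m : M => ∃ p : X × Y, code p = m :=
      Dfn.ex (Dfn.eq DfnF.id.snd.code DfnF.id.fst)
    obtain ⟨s, hs⟩ := exists_separation h e
    refine ⟨s, fun m => (hs m).trans ⟨fun h => h.2, fun h => ⟨(he m).2 ?_, h⟩⟩⟩
    obtain ⟨⟨x, y⟩, rfl⟩ := h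
    intro u hu
    rw [hd]
    intro t ht
    rw [hc, ha, hb]
    rcases (isPair_pair _ _ u).1 hu with h | h
    · exact Or.inl ⟨x, ((h t).1 ht).symm⟩
    · exact ((h t).1 ht).imp (fun h => ⟨x, h.symm⟩) fun h => ⟨y, h.symm⟩

noncomputable instance {a : M} : Coded M (El a) where
  code := El.val
  code_injective := Subtype.val_injective
  rawDef_range := (RawDef.mem (RawDef.Term.var 0) (RawDef.Term.const a)).congr fun v =>
    ⟨by rintro ⟨x, hx⟩; exact hx ▸ x.2, fun h => ⟨⟨v 0, h⟩, rfl⟩⟩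

instance {a : M} : Small M (El a) where
  exists_set := ⟨a, fun m => ⟨fun h => ⟨⟨m, h⟩, rfl⟩, by rintro ⟨x, rfl⟩; exact x.2⟩⟩

theorem DfnF.val {a : M} {f : Z → El a} (hf : DfnF M f) : DfnF M fun z => (f z).val := hf.code

/-! ## Subsets -/

variable (M X) in
/-- The subsets of `X` in the model. -/
def ISet : Type u := {S : Set X // Dfn M fun x => x ∈ S}

instance : Membership X (ISet M X) := ⟨fun S x => x ∈ S.1⟩

@[ext] theorem ISet.ext {S T : ISet M X} (h : ∀ x, x ∈ S ↔ x ∈ T) : S = T :=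
  Subtype.ext (Set.ext h)

theorem ISet.dfn (S : ISet M X) : Dfn M fun x => x ∈ S := S.2

variable (M) in
/-- The subset cut out by a definable predicate. -/
def ISet.of (P : X → Prop) (h : Dfn M P) : ISet M X := ⟨{x | P x}, h⟩

@[simp] theorem ISet.mem_of {P : X → Prop} {h : Dfn M P} {x : X} : x ∈ ISet.of M P h ↔ P x :=
  Iff.rfl

/-- Extensionality leaves only one candidate for the code, so `choose` makes no real choice here. -/
noncomputable instance [Small M X] : Coded M (ISet M X) where
  code := fun S => (exists_set_of_dfn S.dfn).choose
  code_injective := fun S T h => by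
    have hS := (exists_set_of_dfn S.dfn).choose_spec
    have hT := (exists_set_of_dfn T.dfn).choose_spec
    ext x
    constructor
    · intro hx
      have := (hS (code x)).2 ⟨x, rfl, hx⟩
      change (exists_set_of_dfn S.dfn).choose = (exists_set_of_dfn T.dfn).choose at h
      rw [h, hT] at this
      obtain ⟨y, hy, h⟩ := this
      exact code_injective hy ▸ h
    · intro hx
      have := (hT (code x)).2 ⟨x, rfl, hx⟩
      change (exists_set_of_dfn S.dfn).choose = (exists_set_of_dfn T.dfn).choose at h
      rw [← h, hS] at this
      obtain ⟨y, hy, h⟩ := this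
      exact code_injective hy ▸ h
  rawDef_range := by
    have h : Dfn M fun s : M => ∀ m : M, m ∈ s → ∃ x : X, code x = m :=
      Dfn.all (Dfn.imp (Dfn.mem DfnF.id.snd DfnF.id.fst)
        (Dfn.ex (Dfn.eq DfnF.id.snd.code DfnF.id.fst.snd)))
    refine h.raw_self.congr fun v => ⟨?_, fun h => ?_⟩
    · rintro ⟨S, hS⟩ m hm
      rw [← hS] at hm
      obtain ⟨x, hx, -⟩ := ((exists_set_of_dfn S.dfn).choose_spec m).1 hm
      exact ⟨x, hx⟩
    · refine ⟨ISet.of M (fun x => code x ∈ v 0) (Dfn.mem DfnF.id.code (DfnF.const _)), ?_⟩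
      refine ext_of_mem fun m => ((exists_set_of_dfn
        (ISet.dfn (ISet.of M (fun x : X => code x ∈ v 0) _))).choose_spec m).trans ⟨?_, fun hm => ?_⟩
      · rintro ⟨x, rfl, hx⟩
        exact hx
      · obtain ⟨x, hx⟩ := h m hm
        exact ⟨x, hx, show code x ∈ v 0 from hx ▸ hm⟩

theorem ISet.mem_code [Small M X] {S : ISet M X} {m : M} :
    m ∈ (code S : M) ↔ ∃ x : X, code x = m ∧ x ∈ S :=
  (exists_set_of_dfn S.dfn).choose_spec m

theorem ISet.code_mem_code [Small M X] {S : ISet M X} {x : X} :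
    (code x : M) ∈ (code S : M) ↔ x ∈ S := by
  rw [ISet.mem_code]
  exact ⟨fun ⟨y, h, hy⟩ => code_injective h ▸ hy, fun h => ⟨x, rfl, h⟩⟩

theorem Dfn.mem_iset [Small M X] {f : Z → X} {g : Z → ISet M X} (hf : DfnF M f) (hg : DfnF M g) :
    Dfn M fun z => f z ∈ g z :=
  (Dfn.mem hf.code hg.code).congr fun _ => ISet.code_mem_code.symm

instance [Small M X] : Small M (ISet M X) where
  exists_set := by
    obtain ⟨a, ha⟩ := Small.exists_set (M := M) (X := X)
    obtain ⟨s, hs⟩ := ZFDC.isModel.powerset a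
    refine ⟨s, fun m => (hs m).trans ⟨fun h => ?_, ?_⟩⟩
    · refine ⟨ISet.of M (fun x => code x ∈ m) (Dfn.mem DfnF.id.code (DfnF.const _)), ?_⟩
      refine ext_of_mem fun t => ISet.mem_code.trans ⟨?_, fun ht => ?_⟩
      · rintro ⟨x, rfl, hx⟩
        exact hx
      · obtain ⟨x, hx⟩ := (ha t).1 (h t ht)
        exact ⟨x, hx, show code x ∈ m from hx ▸ ht⟩
    · rintro ⟨S, rfl⟩ t ht
      obtain ⟨x, hx, -⟩ := ISet.mem_code.1 ht
      exact (ha t).2 ⟨x, hx⟩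

/-! ## Functions -/

variable (M X Y) in
/-- The functions from `X` to `Y` in the model. -/
def IFun : Type u := {f : X → Y // DfnF M f}

instance : FunLike (IFun M X Y) X Y := ⟨Subtype.val, Subtype.val_injective⟩

theorem IFun.dfn (f : IFun M X Y) : DfnF M f := f.2

variable (M) in
/-- A definable function, as a function of the model. -/
def IFun.of (f : X → Y) (h : DfnF M f) : IFun M X Y := ⟨f, h⟩

@[simp] theorem IFun.of_apply {f : X → Y} {h : DfnF M f} {x : X} : IFun.of M f h x = f x := rfl

/-- The graph of a function of the model. -/
def IFun.graph (f : IFun M X Y) : ISet M (X × Y) := ⟨{p | f p.1 = p.2}, f.dfn⟩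

theorem IFun.mem_graph {f : IFun M X Y} {x : X} {y : Y} : (x, y) ∈ f.graph ↔ f x = y := Iff.rfl

theorem IFun.graph_injective : Function.Injective (IFun.graph : IFun M X Y → _) := fun f g h => by
  refine DFunLike.ext _ _ fun x => ?_
  rw [← IFun.mem_graph, h, IFun.mem_graph]

/-- Being a graph becomes a condition that quantifies over points only. This is what allows
functions to be coded by their graphs. -/
theorem IFun.exists_graph_eq {S : ISet M (X × Y)} :
    (∃ f : IFun M X Y, f.graph = S) ↔ ∀ x, ∃ y, (x, y) ∈ S ∧ ∀ y', (x, y') ∈ S → y' = y := by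
  constructor
  · rintro ⟨f, rfl⟩ x
    exact ⟨f x, rfl, fun y h => Eq.symm h⟩
  · intro h
    choose f hf hf' using h
    have e : ∀ x y, f x = y ↔ (x, y) ∈ S :=
      fun x y => ⟨by rintro rfl; exact hf x, fun h => (hf' x y h).symm⟩
    exact ⟨⟨f, S.dfn.congr fun p => e p.1 p.2⟩, ISet.ext fun p => e p.1 p.2⟩

theorem IFun.dfn_isGraph [Small M X] [Small M Y] :
    Dfn M fun S : ISet M (X × Y) => ∃ f : IFun M X Y, f.graph = S := by
  refine Dfn.congr ?_ fun S => IFun.exists_graph_eq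
  exact Dfn.all (Dfn.ex (Dfn.and (Dfn.mem_iset (DfnF.id.fst.snd.prodMk DfnF.id.snd) DfnF.id.fst.fst)
    (Dfn.all (Dfn.imp (Dfn.mem_iset (DfnF.id.fst.fst.snd.prodMk DfnF.id.snd) DfnF.id.fst.fst.fst)
      (Dfn.eq DfnF.id.snd DfnF.id.fst.snd)))))

noncomputable instance [Small M X] [Small M Y] : Coded M (IFun M X Y) where
  code := fun f => code f.graph
  code_injective := fun f g h => IFun.graph_injective (code_injective h)
  rawDef_range := RawDef.congr IFun.dfn_isGraph fun v => ⟨fun ⟨f, h⟩ => ⟨f.graph, h, f, rfl⟩, by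
    rintro ⟨_, h, f, rfl⟩
    exact ⟨f, h⟩⟩

instance [Small M X] [Small M Y] : Small M (IFun M X Y) where
  exists_set := by
    obtain ⟨s, hs⟩ := exists_set_of_dfn (IFun.dfn_isGraph (M := M) (X := X) (Y := Y))
    refine ⟨s, fun m => (hs m).trans ⟨?_, fun ⟨f, h⟩ => ⟨f.graph, h, f, rfl⟩⟩⟩
    rintro ⟨_, h, f, rfl⟩
    exact ⟨f, h⟩

theorem DfnF.graph [Small M X] [Small M Y] {f : Z → IFun M X Y} (hf : DfnF M f) :
    DfnF M fun z => (f z).graph := by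
  refine DfnF.of_unique (P := fun z S => (Coded.code (f z) : M) = Coded.code S) ?_ fun z S => ?_
  · exact Dfn.eq (DfnF.comp hf DfnF.id.fst).code DfnF.id.snd.code
  · exact ⟨by rintro rfl; rfl, fun h => code_injective h⟩

theorem DfnF.app [Small M X] [Small M Y] {f : Z → IFun M X Y} {g : Z → X} (hf : DfnF M f)
    (hg : DfnF M g) : DfnF M fun z => f z (g z) :=
  DfnF.of_unique (P := fun z y => (g z, y) ∈ (f z).graph)
    (Dfn.mem_iset ((hg.comp DfnF.id.fst).prodMk DfnF.id.snd) (hf.comp DfnF.id.fst).graph)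
    fun _ _ => Iff.rfl

/-! ## Definable operations -/

variable (M X) in
/-- Multiplication is definable. -/
class DfnMul [Mul X] : Prop where
  mul : DfnF M fun p : X × X => p.1 * p.2

variable (M X) in
/-- Addition is definable. -/
class DfnAdd [Add X] : Prop where
  add : DfnF M fun p : X × X => p.1 + p.2

variable (M X) in
/-- The order is definable. -/
class DfnLE [LE X] : Prop where
  le : Dfn M fun p : X × X => p.1 ≤ p.2

theorem DfnF.mul [Mul X] [DfnMul M X] {f g : Z → X} (hf : DfnF M f) (hg : DfnF M g) :
    DfnF M fun z => f z * g z := DfnF.comp₂ DfnMul.mul hf hg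

theorem DfnF.add [Add X] [DfnAdd M X] {f g : Z → X} (hf : DfnF M f) (hg : DfnF M g) :
    DfnF M fun z => f z + g z := DfnF.comp₂ DfnAdd.add hf hg

theorem DfnF.inv [Group X] [DfnMul M X] {f : Z → X} (hf : DfnF M f) :
    DfnF M fun z => (f z)⁻¹ :=
  DfnF.of_unique (P := fun z y => f z * y = 1)
    (Dfn.eq ((hf.comp DfnF.id.fst).mul DfnF.id.snd) (DfnF.const _)) fun _ _ => inv_eq_iff_mul_eq_one

theorem DfnF.neg [AddGroup X] [DfnAdd M X] {f : Z → X} (hf : DfnF M f) :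
    DfnF M fun z => -f z :=
  DfnF.of_unique (P := fun z y => f z + y = 0)
    (Dfn.eq ((hf.comp DfnF.id.fst).add DfnF.id.snd) (DfnF.const _)) fun _ _ => neg_eq_iff_add_eq_zero

theorem DfnF.sub [AddGroup X] [DfnAdd M X] {f g : Z → X} (hf : DfnF M f) (hg : DfnF M g) :
    DfnF M fun z => f z - g z := (hf.add hg.neg).congr fun _ => sub_eq_add_neg _ _

variable (M) in
/-- Membership in the subgroup is definable. -/
class DfnSubgroup [Group X] (S : Subgroup X) : Prop where
  mem : Dfn M fun x => x ∈ S

theorem Dfn.mem_subgroup [Group X] {S : Subgroup X} [DfnSubgroup M S] {f : Z → X}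
    (hf : DfnF M f) : Dfn M fun z => f z ∈ S := Dfn.comp DfnSubgroup.mem hf

theorem Dfn.le [LE X] [DfnLE M X] {f g : Z → X} (hf : DfnF M f) (hg : DfnF M g) :
    Dfn M fun z => f z ≤ g z := Dfn.comp₂ DfnLE.le hf hg

theorem Dfn.lt [LinearOrder X] [DfnLE M X] {f g : Z → X} (hf : DfnF M f) (hg : DfnF M g) :
    Dfn M fun z => f z < g z := (Dfn.le hg hf).not.congr fun _ => not_le.symm

theorem Dfn.ne {f g : Z → X} (hf : DfnF M f) (hg : DfnF M g) : Dfn M fun z => f z ≠ g z :=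
  (Dfn.eq hf hg).not

theorem DfnF.ite {p : Z → Prop} [DecidablePred p] {f g : Z → X} (hp : Dfn M p) (hf : DfnF M f)
    (hg : DfnF M g) : DfnF M fun z => if p z then f z else g z :=
  DfnF.of_unique (P := fun z y => (p z ∧ f z = y) ∨ (¬ p z ∧ g z = y))
    (((hp.comp DfnF.id.fst).and (Dfn.eq (hf.comp DfnF.id.fst) DfnF.id.snd)).or
      ((hp.comp DfnF.id.fst).not.and (Dfn.eq (hg.comp DfnF.id.fst) DfnF.id.snd)))
    fun z y => by by_cases h : p z <;> simp [h]

end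

/-- Proves definability of predicates and functions built from the operations above. -/
theorem by_dfn {p : Prop} (h : p := by
    repeat' with_reducible first
      | exact DfnF.const _
      | exact DfnF.id
      | assumption
      | exact Dfn.const _
      | apply Dfn.and
      | apply Dfn.or
      | apply Dfn.iff
      | apply Dfn.imp
      | apply Dfn.ne
      | apply Dfn.not
      | apply Dfn.ex
      | apply Dfn.all
      | apply Dfn.eq
      | apply Dfn.mem_iset
      | apply Dfn.mem_subgroup
      | apply Dfn.lt
      | apply Dfn.le
      | apply Dfn.mem
      | apply DfnF.fst
      | apply DfnF.snd
      | apply DfnF.app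
      | apply DfnF.val
      | apply DfnF.mul
      | apply DfnF.inv
      | apply DfnF.add
      | apply DfnF.sub
      | apply DfnF.neg
      | apply DfnF.ite
      | apply DfnF.prodMk) : p := h

end

section

variable {M : Type u} [Membership M M] [ZFDC M]

open Coded

/-! ## Internal sets, relations and functions are the definable ones -/

section

variable {a b c : M}

/-- The hinge between the statement and the proof: one direction uses the set as a parameter, the
other is separation. -/
theorem internal_iff_dfn {S : Set (El a)} : Internal S ↔ Dfn M fun x => x ∈ S := by
  constructor
  · rintro ⟨s, rfl⟩
    exact Dfn.mem DfnF.id.val (DfnF.const s)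
  · intro h
    obtain ⟨s, hs⟩ := exists_set_of_dfn h
    refine ⟨s, Set.ext fun x => ⟨fun hx => (hs _).2 ⟨x, rfl, hx⟩, fun hx => ?_⟩⟩
    obtain ⟨y, hy, h⟩ := (hs _).1 hx
    exact code_injective hy ▸ h

theorem internalRel_iff_dfn {r : El a → El b → Prop} :
    InternalRel r ↔ Dfn M fun p : El a × El b => r p.1 p.2 := by
  constructor
  · rintro ⟨s, hs⟩
    refine Dfn.congr (Dfn.mem DfnF.id.code (DfnF.const s)) fun p => (hs p.1 p.2).trans ?_
    simp only [isPair_iff, exists_eq_left]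
    exact Iff.rfl
  · intro h
    obtain ⟨s, hs⟩ := exists_set_of_dfn h
    refine ⟨s, fun x y => ?_⟩
    simp only [isPair_iff, exists_eq_left]
    constructor
    · exact fun hr => (hs _).2 ⟨(x, y), rfl, hr⟩
    · intro hr
      obtain ⟨p, hp, h⟩ := (hs _).1 hr
      obtain rfl : p = (x, y) := code_injective hp
      exact h

theorem internalFun_iff_dfnF {f : El a → El b} : InternalFun f ↔ DfnF M f :=
  internalRel_iff_dfn

theorem InternalFun₂.dfnF {f : El a → El b → El c} (h : InternalFun₂ f) :
    DfnF M fun p : El a × El b => f p.1 p.2 := by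
  obtain ⟨s, hs⟩ := h
  refine Dfn.congr (Dfn.mem DfnF.id.code (DfnF.const s)) fun p => (hs p.1.1 p.1.2 p.2).trans ?_
  simp only [isPair_iff, exists_and_left, exists_eq_left]
  exact Iff.rfl

end

/-! ## Natural numbers -/

variable {ω : M} [hω : Fact (IsOmega ω)]

namespace Omega

theorem exists_zero : ∃ e : El ω, IsEmptySet e.val :=
  let ⟨e, he, h⟩ := hω.out.1.1
  ⟨⟨e, h⟩, he⟩

theorem exists_succ (n : El ω) : ∃ m : El ω, IsSucc n.val m.val :=
  let ⟨m, hm, h⟩ := hω.out.1.2 n.val n.2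
  ⟨⟨m, h⟩, hm⟩

variable (ω) in
/-- The number zero. -/
noncomputable def zero : El ω := exists_zero.choose

/-- The successor. -/
noncomputable def succ (n : El ω) : El ω := (exists_succ n).choose

theorem not_mem_zero (x : M) : x ∉ (zero ω).val := (exists_zero (ω := ω)).choose_spec x

theorem isSucc_succ (n : El ω) : IsSucc n.val (succ n).val := (exists_succ n).choose_spec

theorem mem_succ {n : El ω} {x : M} : x ∈ (succ n).val ↔ x ∈ n.val ∨ x = n.val := isSucc_succ n x

theorem eq_succ_iff {n m : El ω} : m = succ n ↔ IsSucc n.val m.val := by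
  constructor
  · rintro rfl
    exact isSucc_succ n
  · intro h
    exact Subtype.ext (ext_of_mem fun x => (h x).trans mem_succ.symm)

/-- The elements satisfying `P` form an inductive set of `M`, and `ω` is the least one. Definability
of `P` is essential, since `ω` may have nonstandard elements. -/
theorem induction {P : El ω → Prop} (hP : Dfn M P) (h0 : P (zero ω))
    (h : ∀ n, P n → P (succ n)) (n : El ω) : P n := by
  obtain ⟨s, hs⟩ := exists_set_of_dfn hP
  have hi : IsInductive s := by
    refine ⟨⟨(zero ω).val, not_mem_zero, (hs _).2 ⟨_, rfl, h0⟩⟩, fun n hn => ?_⟩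
    obtain ⟨m, rfl, hm⟩ := (hs _).1 hn
    exact ⟨_, isSucc_succ m, (hs _).2 ⟨_, rfl, h m hm⟩⟩
  obtain ⟨m, hm, h⟩ := (hs _).1 (hω.out.2 s hi n.val n.2)
  exact code_injective hm ▸ h

theorem dfnF_succ {Z : Type u} [Coded M Z] {f : Z → El ω} (hf : DfnF M f) :
    DfnF M fun z => succ (f z) :=
  (DfnF.of_unique (f := succ) (P := fun n m : El ω => ∀ x : M, x ∈ m.val ↔ x ∈ n.val ∨ x = n.val)
    by_dfn fun n m => eq_comm.trans eq_succ_iff).comp hf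

/-- The order of the natural numbers is membership. -/
instance {w : M} [Fact (IsOmega w)] : LT (El w) := ⟨fun m n => m.val ∈ n.val⟩

instance {w : M} [Fact (IsOmega w)] : LE (El w) := ⟨fun m n => m < n ∨ m = n⟩

theorem not_lt_zero (n : El ω) : ¬ n < zero ω := not_mem_zero _

theorem lt_succ_iff {m n : El ω} : m < succ n ↔ m ≤ n :=
  mem_succ.trans (or_congr Iff.rfl Subtype.val_injective.eq_iff)

theorem dfn_lt {Z : Type u} [Coded M Z] {f g : Z → El ω} (hf : DfnF M f) (hg : DfnF M g) :
    Dfn M fun z => f z < g z := Dfn.mem hf.val hg.val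

instance : DfnLE M (El ω) := ⟨Dfn.or (dfn_lt by_dfn by_dfn) by_dfn⟩

theorem lt_trans' {a b c : El ω} (hab : a < b) (hbc : b < c) : a < c := by
  revert hbc
  refine induction (P := fun c : El ω => b < c → a < c)
    (Dfn.imp (dfn_lt by_dfn by_dfn) (dfn_lt by_dfn by_dfn)) (fun h => (not_lt_zero _ h).elim) ?_ c
  intro n ih h
  rw [lt_succ_iff] at h ⊢
  rcases h with h | rfl
  · exact Or.inl (ih h)
  · exact Or.inl hab

theorem lt_succ_self (n : El ω) : n < succ n := lt_succ_iff.2 (Or.inr rfl)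

theorem lt_irrefl' (n : El ω) : ¬ n < n := by
  refine induction (P := fun n : El ω => ¬ n < n) (Dfn.not (dfn_lt by_dfn by_dfn))
    (not_lt_zero _) ?_ n
  intro n ih h
  rcases lt_succ_iff.1 h with h | h
  · exact ih (lt_trans' (lt_succ_self n) h)
  · have h' := lt_succ_self n
    rw [h] at h'
    exact ih h'

theorem zero_le (n : El ω) : zero ω ≤ n := by
  refine induction (P := fun n : El ω => zero ω ≤ n) by_dfn (Or.inr rfl) ?_ n
  intro n ih
  exact Or.inl (lt_succ_iff.2 ih)

theorem succ_le_of_lt {m n : El ω} (h : m < n) : succ m ≤ n := by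
  revert h
  refine induction (P := fun n : El ω => m < n → succ m ≤ n)
    (Dfn.imp (dfn_lt by_dfn by_dfn) by_dfn) (fun h => (not_lt_zero _ h).elim) ?_ n
  intro n ih h
  rcases lt_succ_iff.1 h with h | rfl
  · exact Or.inl (lt_succ_iff.2 (ih h))
  · exact Or.inr rfl

theorem trichotomy (m n : El ω) : m < n ∨ m = n ∨ n < m := by
  refine induction (P := fun n : El ω => m < n ∨ m = n ∨ n < m)
    (Dfn.or (dfn_lt by_dfn by_dfn) (Dfn.or by_dfn (dfn_lt by_dfn by_dfn))) ?_ ?_ n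
  · rcases zero_le m with h | h
    · exact Or.inr (Or.inr h)
    · exact Or.inr (Or.inl h.symm)
  · rintro n (h | rfl | h)
    · exact Or.inl (lt_succ_iff.2 (Or.inl h))
    · exact Or.inl (lt_succ_self _)
    · rcases succ_le_of_lt h with h | h
      · exact Or.inr (Or.inr h)
      · exact Or.inr (Or.inl h.symm)

noncomputable instance : LinearOrder (El ω) where
  lt m n := m.val ∈ n.val
  le m n := m < n ∨ m = n
  le_refl _ := Or.inr rfl
  le_trans a b c := by
    rintro (h | rfl) (h' | rfl)
    · exact Or.inl (lt_trans' h h')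
    · exact Or.inl h
    · exact Or.inl h'
    · exact Or.inr rfl
  le_antisymm a b := by
    rintro (h | h) (h' | h')
    · exact (lt_irrefl' _ (lt_trans' h h')).elim
    all_goals first | exact h | exact h'.symm
  le_total a b := by
    rcases trichotomy a b with h | h | h
    · exact Or.inl (Or.inl h)
    · exact Or.inl (Or.inr h)
    · exact Or.inr (Or.inl h)
  lt_iff_le_not_ge a b := by
    constructor
    · intro h
      refine ⟨Or.inl h, ?_⟩
      rintro (h' | rfl)
      · exact lt_irrefl' _ (lt_trans' h h')
      · exact lt_irrefl' _ h
    · rintro ⟨h | rfl, h'⟩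
      · exact h
      · exact (h' (Or.inr rfl)).elim
  toDecidableLE := Classical.decRel _

theorem lt_iff_val {m n : El ω} : m < n ↔ m.val ∈ n.val := Iff.rfl

theorem exists_least {P : El ω → Prop} (hP : Dfn M P) (h : ∃ n, P n) :
    ∃ n, P n ∧ ∀ m, P m → n ≤ m := by
  by_contra! hc
  obtain ⟨n, hn⟩ := h
  -- Without a least element, induction on `k` shows that no element up to `k` satisfies `P`.
  have key : ∀ k : El ω, ∀ m, m ≤ k → ¬ P m := by
    refine induction (P := fun k : El ω => ∀ m, m ≤ k → ¬ P m)
      (Dfn.all (Dfn.imp by_dfn (hP.comp by_dfn).not)) ?_ ?_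
    · intro m hm hPm
      obtain ⟨l, -, hl⟩ := hc m hPm
      exact not_lt_zero l (hl.trans_le hm)
    · intro k ih m hm hPm
      obtain ⟨l, hPl, hl⟩ := hc m hPm
      exact ih l (lt_succ_iff.1 (hl.trans_le hm)) hPl
  exact key n n le_rfl hn

end Omega

open Omega

/-! ## Dependent choice -/

section

variable {X Y : Type u} [Coded M X] [Small M X] [Coded M Y]

variable (ω) in
-- Dependent choice transported along codes to a definable part of a small type. The first term is
-- not prescribed.
theorem exists_seq {P : X → Prop} {r : X → X → Prop} (hP : Dfn M P)
    (hr : Dfn M fun p : X × X => r p.1 p.2) (hne : ∃ x, P x)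
    (h : ∀ x, P x → ∃ y, P y ∧ r x y) :
    ∃ f : IFun M (El ω) X, ∀ n, P (f n) ∧ r (f n) (f (succ n)) := by
  obtain ⟨s, hs⟩ := exists_set_of_dfn hP
  have hx : ∀ m : El s, ∃ x : X, code x = m.val ∧ P x := fun m => (hs _).1 m.2
  -- The map `d` inverts `code`, which is injective; hence it is unique and definable although it is
  -- chosen outside `M`.
  choose d hd hPd using hx
  have hdF : DfnF M d := by
    refine DfnF.of_unique (P := fun (m : El s) x => (m.val : M) = code x)
      (Dfn.eq by_dfn DfnF.id.snd.code) fun m x => ⟨?_, fun h => ?_⟩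
    · rintro rfl
      exact (hd m).symm
    · exact code_injective ((hd m).trans h)
  have hmk : ∀ x, P x → ∃ m : El s, d m = x := fun x h => by
    refine ⟨⟨code x, (hs _).2 ⟨x, rfl, h⟩⟩, code_injective (hd _)⟩
  have hr' : Dfn M fun p : El s × El s => r (d p.1) (d p.2) :=
    hr.comp ((hdF.comp by_dfn).prodMk (hdF.comp by_dfn))
  obtain ⟨f, hf, h⟩ := ZFDC.isModel.dependentChoice ω hω.out s (fun a b => r (d a) (d b))
    (internalRel_iff_dfn.2 hr')
    (let ⟨x, hx⟩ := hne; let ⟨m, _⟩ := hmk x hx; ⟨m⟩)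
    (fun a => by
      obtain ⟨y, hy, hay⟩ := h (d a) (hPd a)
      obtain ⟨b, rfl⟩ := hmk y hy
      exact ⟨b, hay⟩)
  exact ⟨IFun.of M (fun n => d (f n)) (hdF.comp (internalFun_iff_dfnF.1 hf)),
    fun n => ⟨hPd _, h n (succ n) (isSucc_succ n)⟩⟩

/-- To prescribe the first term and let the relation depend on the stage, dependent choice is
applied to finite approximations, and the diagonal is taken. -/
theorem exists_seq_from {P : X → Prop} {r : El ω → X → X → Prop} (hP : Dfn M P)
    (hr : Dfn M fun p : (El ω × X) × X => r p.1.1 p.1.2 p.2) (x₀ : X) (h₀ : P x₀)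
    (h : ∀ n x, P x → ∃ y, P y ∧ r n x y) :
    ∃ f : IFun M (El ω) X, f (zero ω) = x₀ ∧ ∀ n, P (f n) ∧ r n (f n) (f (succ n)) := by
  classical
  -- An approximation is a pair `(n, f)` in which only the values of `f` up to `n` matter.
  let T : El ω × IFun M (El ω) X → Prop := fun t => t.2 (zero ω) = x₀ ∧ P (t.2 t.1) ∧
    ∀ k, k < t.1 → P (t.2 k) ∧ r k (t.2 k) (t.2 (succ k))
  have hT : Dfn M T := by
    refine Dfn.and by_dfn (Dfn.and (hP.comp by_dfn) (Dfn.all (Dfn.imp by_dfn (Dfn.and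
      (hP.comp by_dfn) ?_))))
    exact hr.comp ((DfnF.prodMk by_dfn by_dfn).prodMk (DfnF.app by_dfn (dfnF_succ by_dfn)))
  obtain ⟨g, hg⟩ := exists_seq ω (P := T) (r := fun s t => t.1 = succ s.1 ∧
      ∀ k, k ≤ s.1 → t.2 k = s.2 k) hT
    (Dfn.and (Dfn.eq by_dfn (dfnF_succ by_dfn)) by_dfn)
    ⟨(zero ω, IFun.of M (fun _ => x₀) by_dfn), rfl, h₀, fun k hk => (not_lt_zero k hk).elim⟩ <| by
      rintro ⟨n, f⟩ ⟨h1, h2, h3⟩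
      obtain ⟨y, hy, hry⟩ := h n (f n) h2
      refine ⟨(succ n, IFun.of M (fun k => if k ≤ n then f k else y) by_dfn),
        ⟨?_, ?_, ?_⟩, rfl, fun k hk => ?_⟩
      · exact (if_pos (zero_le n)).trans h1
      · simpa [(lt_succ_self n).not_ge] using hy
      · intro k hk
        have hkn : k ≤ n := lt_succ_iff.1 hk
        simp only [IFun.of_apply, if_pos hkn]
        rcases hkn.lt_or_eq with hkn | rfl
        · rw [if_pos (succ_le_of_lt hkn)]
          exact h3 k hkn
        · rw [if_neg (lt_succ_self k).not_ge]
          exact ⟨h2, hry⟩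
      · simp only [IFun.of_apply]
        exact if_pos hk
  -- The first approximation may already have positive length, so only an inequality is available;
  -- it suffices for the diagonal.
  have hmono : ∀ n, n ≤ (g n).1 := by
    refine induction (P := fun n => n ≤ (g n).1) by_dfn (zero_le _) fun n ih => ?_
    rw [(hg n).2.1]
    exact succ_le_of_lt (lt_succ_iff.2 ih)
  refine ⟨IFun.of M (fun n => (g n).2 n) by_dfn, (hg _).1.1, fun n => ?_⟩
  simp only [IFun.of_apply]
  rw [← (hg n).2.2 n (hmono n)]
  exact (hg (succ n)).1.2.2 n ((lt_succ_self n).trans_le (hmono _))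

/-- Definition by recursion. -/
theorem exists_rec {F : El ω → X → X} (hF : DfnF M fun p : El ω × X => F p.1 p.2) (x₀ : X) :
    ∃ f : IFun M (El ω) X, f (zero ω) = x₀ ∧ ∀ n, f (succ n) = F n (f n) := by
  obtain ⟨f, h0, h⟩ := exists_seq_from (P := fun _ => True) (r := fun n x y => y = F n x) by_dfn
    (Dfn.eq by_dfn (hF.comp by_dfn)) x₀ trivial (fun n x _ => ⟨_, trivial, rfl⟩)
  exact ⟨f, h0, fun n => (h n).2⟩

end

end

section

variable {M : Type u} [Membership M M] [ZFDC M]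

open Coded

/-! ## Finite subsets -/

section

variable {X Y Z : Type u} [Coded M X] [Small M X] [Coded M Y] [Small M Y] [Coded M Z]

/-- `S` belongs to every family of the model that contains the empty set and is closed under
adding one element. -/
def IFin (S : ISet M X) : Prop :=
  ∀ 𝒜 : ISet M (ISet M X), (∀ T : ISet M X, (∀ x, ¬ x ∈ T) → T ∈ 𝒜) →
    (∀ T : ISet M X, T ∈ 𝒜 → ∀ (a : X) (T' : ISet M X), (∀ x, x ∈ T' ↔ x = a ∨ x ∈ T) → T' ∈ 𝒜) →
    S ∈ 𝒜

namespace IFin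

theorem dfn {f : Z → ISet M X} (hf : DfnF M f) : Dfn M fun z => IFin (f z) :=
  Dfn.comp (P := fun S : ISet M X => IFin S) (by unfold IFin; exact by_dfn) hf

/-- The family of finite sets satisfying `P` contains the empty set and is closed under adding a
point. Keeping finiteness in the family makes it available in the inductive step. -/
theorem induction {P : ISet M X → Prop} (hP : Dfn M P) (h0 : ∀ T, (∀ x, ¬ x ∈ T) → P T)
    (h : ∀ T, IFin T → P T → ∀ a T', (∀ x, x ∈ T' ↔ x = a ∨ x ∈ T) → P T') {S : ISet M X}
    (hS : IFin S) : P S := by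
  have h1 := hS (ISet.of M (fun T => IFin T ∧ P T) ((dfn by_dfn).and hP))
    (fun T hT => ⟨fun 𝒜 h0 _ => h0 T hT, h0 T hT⟩)
    (fun T hT a T' e => ⟨fun 𝒜 h0 h1 => h1 T (hT.1 𝒜 h0 h1) a T' e, h T hT.1 hT.2 a T' e⟩)
  exact h1.2

theorem of_empty {T : ISet M X} (h : ∀ x, ¬ x ∈ T) : IFin T := fun _ h0 _ => h0 T h

theorem of_insert {T T' : ISet M X} (hT : IFin T) (a : X) (e : ∀ x, x ∈ T' ↔ x = a ∨ x ∈ T) :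
    IFin T' := fun 𝒜 h0 h1 => h1 T (hT 𝒜 h0 h1) a T' e

theorem exists_union {S T : ISet M X} (hS : IFin S) (hT : IFin T) :
    ∃ U : ISet M X, IFin U ∧ ∀ x, x ∈ U ↔ x ∈ S ∨ x ∈ T := by
  refine induction (P := fun S : ISet M X => ∃ U : ISet M X, IFin U ∧ ∀ x, x ∈ U ↔ x ∈ S ∨ x ∈ T)
    (Dfn.ex (Dfn.and (dfn by_dfn) by_dfn)) ?_ ?_ hS
  · exact fun S hS => ⟨T, hT, fun x => by simp [hS x]⟩
  · rintro S - ⟨U, hU, hU'⟩ a S' e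
    refine ⟨ISet.of M (fun x => x = a ∨ x ∈ U) by_dfn, hU.of_insert a fun x => Iff.rfl, fun x => ?_⟩
    rw [e, or_assoc, ← hU']
    exact Iff.rfl

theorem exists_image {S : ISet M X} (hS : IFin S) (f : IFun M X Y) :
    ∃ U : ISet M Y, IFin U ∧ ∀ y, y ∈ U ↔ ∃ x, x ∈ S ∧ f x = y := by
  refine induction (P := fun S : ISet M X => ∃ U : ISet M Y, IFin U ∧ ∀ y, y ∈ U ↔
    ∃ x, x ∈ S ∧ f x = y) (Dfn.ex (Dfn.and (dfn by_dfn) by_dfn)) ?_ ?_ hS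
  · intro S hS
    exact ⟨ISet.of M (fun _ => False) by_dfn, of_empty fun x h => h, fun y =>
      ⟨False.elim, fun ⟨x, hx, _⟩ => hS x hx⟩⟩
  · rintro S - ⟨U, hU, hU'⟩ a S' e
    refine ⟨ISet.of M (fun y => y = f a ∨ y ∈ U) by_dfn, hU.of_insert (f a) fun x => Iff.rfl,
      fun y => ?_⟩
    simp only [ISet.mem_of, hU', e]
    constructor
    · rintro (rfl | ⟨x, hx, rfl⟩)
      · exact ⟨a, Or.inl rfl, rfl⟩
      · exact ⟨x, Or.inr hx, rfl⟩
    · rintro ⟨x, rfl | hx, rfl⟩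
      · exact Or.inl rfl
      · exact Or.inr ⟨x, hx, rfl⟩

end IFin

end

/-! ## Metrics of the model -/

section

variable {ω : M} [hω : Fact (IsOmega ω)]
variable {K : Type u} [Coded M K] [Small M K] [Field K] [LinearOrder K] [IsStrictOrderedRing K]
  [DfnAdd M K] [DfnMul M K] [DfnLE M K]
variable {Γ : Type u} [Coded M Γ] [Small M Γ] [Group Γ] [DfnMul M Γ] [TopologicalSpace Γ]

/-- `D` is a metric compatible with the topology. -/
structure IsCompatibleMetric (D : IFun M (Γ × Γ) K) : Prop where
  eq_zero_iff : ∀ x y, D (x, y) = 0 ↔ x = y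
  symm : ∀ x y, D (x, y) = D (y, x)
  triangle : ∀ x y z, D (x, z) ≤ D (x, y) + D (y, z)
  basis : ∀ x, (nhds x).HasBasis (fun ε : K => 0 < ε) fun ε => {y | D (x, y) < ε}

variable {D : IFun M (Γ × Γ) K}

theorem IsCompatibleMetric.self (hD : IsCompatibleMetric D) (x : Γ) : D (x, x) = 0 :=
  (hD.eq_zero_iff x x).2 rfl

theorem IsCompatibleMetric.ball_mem (hD : IsCompatibleMetric D) (x : Γ) {ε : K} (hε : 0 < ε) :
    {y | D (x, y) < ε} ∈ nhds x := (hD.basis x).mem_of_mem hε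

/-- The topology lives outside `M`, but its balls have radii in `K`, so membership in the closure is
expressed by quantifiers over `K` and `Γ`. -/
theorem IsCompatibleMetric.dfnSubgroup_closure [IsTopologicalGroup Γ] (hD : IsCompatibleMetric D)
    (F : Subgroup Γ) [DfnSubgroup M F] : DfnSubgroup M F.topologicalClosure := by
  constructor
  have h : Dfn M fun x : Γ => ∀ ε : K, 0 < ε → ∃ f : Γ, f ∈ F ∧ D (x, f) < ε := by_dfn
  refine h.congr fun x => ?_
  change x ∈ closure (F : Set Γ) ↔ _
  rw [mem_closure_iff_nhds_basis (hD.basis x)]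
  exact Iff.rfl

/-- If a dense subgroup `F` of `H` is not covered by finitely many cosets, then a finite set of cosets
can be moved off a finite set of cosets by an element of `H` close to the identity. -/
theorem exists_displacement [IsTopologicalGroup Γ] (hD : IsCompatibleMetric D)
    (F : Subgroup Γ) [DfnSubgroup M F] (hinf : ¬ ∃ Y : ISet M Γ, IFin Y ∧
      ∀ h, h ∈ F.topologicalClosure → ∃ y, y ∈ Y ∧ y⁻¹ * h ∈ F)
    {X : ISet M Γ} (hX : IFin X) (hXH : ∀ x, x ∈ X → x ∈ F.topologicalClosure)
    {Y : ISet M Γ} (hY : IFin Y) (hYH : ∀ y, y ∈ Y → y ∈ F.topologicalClosure)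
    {ε : K} (hε : 0 < ε) :
    ∃ g, g ∈ F.topologicalClosure ∧ D (1, g) < ε ∧ ∀ x, x ∈ X → ∀ y, y ∈ Y → y⁻¹ * g * x ∉ F := by
  have := hD.dfnSubgroup_closure F
  set H := F.topologicalClosure with hH
  have hFH : F ≤ H := F.le_topologicalClosure
  -- one point can be moved off a finite set
  have point : ∀ Y : ISet M Γ, IFin Y → ∀ y, y ∈ H → ∀ δ : K, 0 < δ →
      ∃ h, h ∈ H ∧ D (1, h) < δ ∧ ∀ y', y' ∈ Y → y'⁻¹ * h * y ∉ F := by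
    intro Y hY y hy δ hδ
    have : ∃ w ∈ H, ∀ y', y' ∈ Y → y'⁻¹ * w ∉ F := by
      by_contra! hc
      exact hinf ⟨Y, hY, hc⟩
    obtain ⟨w, hw, hwY⟩ := this
    have hc : Filter.Tendsto (fun f => w * f * y⁻¹) (nhds (w⁻¹ * y)) (nhds 1) := by
      have : Continuous fun f => w * f * y⁻¹ := by fun_prop
      simpa using this.tendsto (w⁻¹ * y)
    have hm : w⁻¹ * y ∈ closure (F : Set Γ) := H.mul_mem (H.inv_mem hw) hy
    obtain ⟨f, hf, hfF⟩ := mem_closure_iff_nhds.1 hm _ (hc (hD.ball_mem 1 hδ))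
    -- With `w` outside all cosets `y' F` and `f ∈ F` close to `w⁻¹ * y`, the element `h = w * f *
    -- y⁻¹` is close to `1`, and `h * y = w * f` lies in the coset `w F`.
    refine ⟨w * f * y⁻¹, H.mul_mem (H.mul_mem hw (hFH hfF)) (H.inv_mem hy), hf, fun y' hy' h => ?_⟩
    refine hwY y' hy' ?_
    have := F.mul_mem h (F.inv_mem hfF)
    simpa [mul_assoc] using this
  -- For each point of `Y₀` a small displacement `h` is fixed in advance, and a single finite set
  -- `Y'` collects all the translates `h⁻¹ * Y`.
  have points : ∀ (δ : K), 0 < δ → ∀ Y : ISet M Γ, IFin Y → (∀ y, y ∈ Y → y ∈ H) →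
      ∀ Y₀ : ISet M Γ, IFin Y₀ → (∀ y, y ∈ Y₀ → y ∈ H) →
      ∃ Y' : ISet M Γ, IFin Y' ∧ (∀ y, y ∈ Y' → y ∈ H) ∧ ∀ y, y ∈ Y₀ → ∃ h, h ∈ H ∧ D (1, h) < δ ∧
        (∀ y', y' ∈ Y → y'⁻¹ * h * y ∉ F) ∧ ∀ y', y' ∈ Y → h⁻¹ * y' ∈ Y' := by
    intro δ hδ Y hY hYH Y₀ hY₀
    refine IFin.induction (P := fun Y₀ : ISet M Γ => (∀ y, y ∈ Y₀ → y ∈ H) →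
      ∃ Y' : ISet M Γ, IFin Y' ∧ (∀ y, y ∈ Y' → y ∈ H) ∧ ∀ y, y ∈ Y₀ → ∃ h, h ∈ H ∧ D (1, h) < δ ∧
        (∀ y', y' ∈ Y → y'⁻¹ * h * y ∉ F) ∧ ∀ y', y' ∈ Y → h⁻¹ * y' ∈ Y')
      (Dfn.imp by_dfn (Dfn.ex (Dfn.and (IFin.dfn by_dfn) by_dfn))) ?_ ?_ hY₀
    · exact fun T hT _ => ⟨Y, hY, hYH, fun y hy => (hT y hy).elim⟩
    · intro T _ ih a T' e hT'
      obtain ⟨Y', hY', hY'H, h1⟩ := ih fun y hy => hT' y ((e y).2 (Or.inr hy))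
      have haH := hT' a ((e a).2 (Or.inl rfl))
      obtain ⟨h, hhH, hhδ, hhY⟩ := point Y hY a haH δ hδ
      obtain ⟨V, hV, hV'⟩ := hY.exists_image (IFun.of M (fun y => h⁻¹ * y) by_dfn)
      obtain ⟨U, hU, hU'⟩ := hY'.exists_union hV
      refine ⟨U, hU, fun y hy => ?_, fun y hy => ?_⟩
      · rcases (hU' y).1 hy with hy | hy
        · exact hY'H y hy
        · obtain ⟨x, hx, rfl⟩ := (hV' y).1 hy
          exact H.mul_mem (H.inv_mem hhH) (hYH x hx)
      · rcases (e y).1 hy with rfl | hy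
        · exact ⟨h, hhH, hhδ, hhY, fun y' hy' => (hU' _).2 (Or.inr ((hV' _).2 ⟨y', hy', rfl⟩))⟩
        · obtain ⟨h, k1, k2, k3, k4⟩ := h1 y hy
          exact ⟨h, k1, k2, k3, fun y' hy' => (hU' _).2 (Or.inl (k4 y' hy'))⟩
  refine IFin.induction (P := fun X : ISet M Γ => (∀ x, x ∈ X → x ∈ H) → ∀ Y : ISet M Γ, IFin Y →
      (∀ y, y ∈ Y → y ∈ H) → ∀ ε : K, 0 < ε → ∃ g, g ∈ H ∧ D (1, g) < ε ∧
      ∀ x, x ∈ X → ∀ y, y ∈ Y → y⁻¹ * g * x ∉ F)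
    (Dfn.imp by_dfn (Dfn.all (Dfn.imp (IFin.dfn by_dfn) by_dfn))) ?_ ?_ hX hXH Y hY hYH ε hε
  · intro T hT _ Y _ _ ε hε
    exact ⟨1, H.one_mem, by rwa [hD.self], fun x hx => (hT x hx).elim⟩
  · intro X _ ih x X' e hX'H Y hY hYH ε hε
    have hxH := hX'H x ((e x).2 (Or.inl rfl))
    have hc : Filter.Tendsto (fun p : Γ × Γ => p.1 * p.2) (nhds 1 ×ˢ nhds 1) (nhds 1) := by
      rw [← nhds_prod_eq]
      have : Continuous fun p : Γ × Γ => p.1 * p.2 := by fun_prop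
      simpa using this.tendsto (1, 1)
    obtain ⟨δ, hδ, hδ'⟩ := (((hD.basis 1).prod_self).tendsto_left_iff).1 hc _ (hD.ball_mem 1 hε)
    obtain ⟨Y', hY', hY'H, h1⟩ := points δ hδ Y hY hYH Y hY hYH
    obtain ⟨U, hU, hU'⟩ := hY'.exists_union hY
    -- The old points are moved off `Y'` as well as `Y`, so that a later correction by one of the
    -- elements `h` cannot bring them back into `Y F`.
    obtain ⟨g, hgH, hgδ, hg⟩ := ih (fun y hy => hX'H y ((e y).2 (Or.inr hy))) U hU
      (fun y hy => ((hU' y).1 hy).elim (hY'H y) (hYH y)) δ hδ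
    by_cases hx : ∀ y, y ∈ Y → y⁻¹ * g * x ∉ F
    · refine ⟨g, hgH, ?_, fun z hz y hy => ?_⟩
      · have : (1, g) ∈ {y : Γ | D (1, y) < δ} ×ˢ {y : Γ | D (1, y) < δ} :=
          ⟨by simpa [hD.self] using hδ, hgδ⟩
        simpa using hδ' this
      · rcases (e z).1 hz with rfl | hz
        · exact hx y hy
        · exact hg z hz y ((hU' y).2 (Or.inr hy))
    · push Not at hx
      obtain ⟨y, hy, hyF⟩ := hx
      -- Here `g * x` fell into `y F`. The displacement `h` prepared for this `y` takes `y F`, and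
      -- with it `g * x`, off `Y F`.
      obtain ⟨h, hhH, hhδ, k1, k2⟩ := h1 y hy
      refine ⟨h * g, H.mul_mem hhH hgH, ?_, fun z hz y' hy' hF => ?_⟩
      · have : (h, g) ∈ {y : Γ | D (1, y) < δ} ×ˢ {y : Γ | D (1, y) < δ} := ⟨hhδ, hgδ⟩
        exact hδ' this
      · rcases (e z).1 hz with rfl | hz
        · refine k1 y' hy' ?_
          have := F.mul_mem hF (F.inv_mem hyF)
          simpa [mul_assoc] using this
        · refine hg z hz (h⁻¹ * y') ((hU' _).2 (Or.inl (k2 y' hy'))) ?_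
          simpa [mul_assoc] using hF

end

end

section

variable {M : Type u} [Membership M M] [ZFDC M]

open Coded Omega

/-! ## The real line -/

variable {ω : M} [hω : Fact (IsOmega ω)]
variable {K : Type u} [Coded M K] [Small M K] [Field K] [LinearOrder K] [IsStrictOrderedRing K]
  [DfnAdd M K] [DfnMul M K] [DfnLE M K]

variable (M K) in
/-- Suprema of the bounded nonempty subsets in the model. -/
class ISupClosed : Prop where
  exists_isLUB : ∀ S : ISet M K, (∃ x, x ∈ S) → (∃ b, ∀ x, x ∈ S → x ≤ b) →
    ∃ b, (∀ x, x ∈ S → x ≤ b) ∧ ∀ c, (∀ x, x ∈ S → x ≤ c) → b ≤ c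

variable (M) in
/-- The rational numbers of the model. -/
def IsRat (x : K) : Prop := ∀ S : Subfield K, (Dfn M fun x => x ∈ S) → x ∈ S

/-- The embedding is defined by recursion in `M`, because the usual cast reaches only the standard
natural numbers. -/
theorem exists_natCast : ∃ ν : IFun M (El ω) K, ν (zero ω) = 0 ∧ ∀ n, ν (succ n) = ν n + 1 :=
  exists_rec (F := fun _ x => x + 1) by_dfn 0

variable (ω K) in
/-- The natural numbers of the model as elements of the real line. -/
noncomputable def natCast : IFun M (El ω) K := exists_natCast.choose

namespace RealLine

@[simp] theorem natCast_zero : natCast ω K (zero ω) = 0 := exists_natCast.choose_spec.1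

@[simp] theorem natCast_succ (n : El ω) : natCast ω K (succ n) = natCast ω K n + 1 :=
  exists_natCast.choose_spec.2 n

theorem natCast_nonneg (n : El ω) : 0 ≤ natCast ω K n := by
  refine induction (P := fun n : El ω => 0 ≤ natCast ω K n) by_dfn (by simp) (fun n ih => ?_) n
  rw [natCast_succ]
  linarith

theorem exists_natCast_add (m n : El ω) : ∃ k : El ω, natCast ω K k = natCast ω K m + natCast ω K n := by
  refine induction (P := fun n : El ω => ∃ k : El ω, natCast ω K k = natCast ω K m + natCast ω K n)
    by_dfn ⟨m, by simp⟩ ?_ n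
  rintro n ⟨k, hk⟩
  exact ⟨succ k, by rw [natCast_succ, natCast_succ, hk, add_assoc]⟩

theorem exists_natCast_mul (m n : El ω) : ∃ k : El ω, natCast ω K k = natCast ω K m * natCast ω K n := by
  refine induction (P := fun n : El ω => ∃ k : El ω, natCast ω K k = natCast ω K m * natCast ω K n)
    by_dfn ⟨zero ω, by simp⟩ ?_ n
  rintro n ⟨k, hk⟩
  obtain ⟨l, hl⟩ := exists_natCast_add (K := K) k m
  exact ⟨l, by rw [natCast_succ, hl, hk]; ring⟩

theorem natCast_add_one_le {m n : El ω} (h : m < n) : natCast ω K m + 1 ≤ natCast ω K n := by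
  revert h
  refine induction (P := fun n : El ω => m < n → natCast ω K m + 1 ≤ natCast ω K n) by_dfn
    (fun h => (not_lt_zero _ h).elim) (fun n ih h => ?_) n
  rw [natCast_succ]
  rcases (lt_succ_iff.1 h).lt_or_eq with h | rfl
  · linarith [ih h]
  · exact le_rfl

theorem natCast_le_natCast {m n : El ω} : natCast ω K m ≤ natCast ω K n ↔ m ≤ n := by
  constructor
  · intro h
    by_contra hc
    linarith [natCast_add_one_le (K := K) (not_le.1 hc)]
  · intro h
    rcases h.lt_or_eq with h | rfl
    · linarith [natCast_add_one_le (K := K) h]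
    · exact le_rfl

variable (ω) in
-- The usual argument: a least upper bound `b` of the natural numbers would make `b - 1` an upper
-- bound too.
theorem exists_lt_natCast [ISupClosed M K] (x : K) : ∃ n : El ω, x < natCast ω K n := by
  by_contra! hc
  obtain ⟨b, hb, hb'⟩ := ISupClosed.exists_isLUB
    (ISet.of M (fun y : K => ∃ n : El ω, natCast ω K n = y) by_dfn) ⟨_, zero ω, rfl⟩
    ⟨x, by rintro _ ⟨n, rfl⟩; exact hc n⟩
  have : b ≤ b - 1 := hb' _ <| by
    rintro _ ⟨n, rfl⟩
    have := hb _ ⟨succ n, rfl⟩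
    rw [natCast_succ] at this
    linarith
  linarith

variable (ω) in
/-- The integers of the model. -/
def IsInt (z : K) : Prop := ∃ m n : El ω, z = natCast ω K m - natCast ω K n

theorem dfn_isInt {Z : Type u} [Coded M Z] {f : Z → K} (hf : DfnF M f) :
    Dfn M fun z => IsInt ω (f z) :=
  Dfn.comp (P := fun z => IsInt ω z) (by unfold IsInt; exact by_dfn) hf

theorem isInt_natCast (n : El ω) : IsInt ω (natCast ω K n) := ⟨n, zero ω, by simp⟩

theorem isInt_zero : IsInt ω (0 : K) := ⟨zero ω, zero ω, by simp⟩

theorem isInt_one : IsInt ω (1 : K) := ⟨succ (zero ω), zero ω, by simp⟩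

theorem IsInt.neg {x : K} (hx : IsInt ω x) : IsInt ω (-x) := by
  obtain ⟨m, n, rfl⟩ := hx
  exact ⟨n, m, by ring⟩

theorem IsInt.add {x y : K} (hx : IsInt ω x) (hy : IsInt ω y) : IsInt ω (x + y) := by
  obtain ⟨m, n, rfl⟩ := hx
  obtain ⟨m', n', rfl⟩ := hy
  obtain ⟨k, hk⟩ := exists_natCast_add (K := K) m m'
  obtain ⟨l, hl⟩ := exists_natCast_add (K := K) n n'
  exact ⟨k, l, by rw [hk, hl]; ring⟩

theorem IsInt.sub {x y : K} (hx : IsInt ω x) (hy : IsInt ω y) : IsInt ω (x - y) := by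
  rw [sub_eq_add_neg]
  exact hx.add hy.neg

theorem IsInt.mul {x y : K} (hx : IsInt ω x) (hy : IsInt ω y) : IsInt ω (x * y) := by
  obtain ⟨m, n, rfl⟩ := hx
  obtain ⟨m', n', rfl⟩ := hy
  obtain ⟨a, ha⟩ := exists_natCast_mul (K := K) m m'
  obtain ⟨b, hb⟩ := exists_natCast_mul (K := K) m n'
  obtain ⟨c, hc⟩ := exists_natCast_mul (K := K) n m'
  obtain ⟨d, hd⟩ := exists_natCast_mul (K := K) n n'
  have e : (natCast ω K m - natCast ω K n) * (natCast ω K m' - natCast ω K n') =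
      (natCast ω K a + natCast ω K d) - (natCast ω K b + natCast ω K c) := by
    rw [ha, hb, hc, hd]; ring
  rw [e]
  exact ((isInt_natCast a).add (isInt_natCast d)).sub ((isInt_natCast b).add (isInt_natCast c))

theorem IsInt.exists_natCast_eq {x : K} (hx : IsInt ω x) (h0 : 0 ≤ x) :
    ∃ n : El ω, x = natCast ω K n := by
  obtain ⟨m, n, rfl⟩ := hx
  revert h0
  refine induction (P := fun m : El ω => 0 ≤ natCast ω K m - natCast ω K n →
    ∃ k : El ω, natCast ω K m - natCast ω K n = natCast ω K k) by_dfn ?_ ?_ m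
  · intro h
    refine ⟨zero ω, ?_⟩
    have := natCast_nonneg (K := K) n
    rw [natCast_zero] at *
    linarith
  · intro m ih h
    rcases le_or_gt n m with hnm | hnm
    · obtain ⟨k, hk⟩ := ih (sub_nonneg.2 (natCast_le_natCast.2 hnm))
      refine ⟨succ k, ?_⟩
      rw [natCast_succ, natCast_succ]
      linarith
    · refine ⟨zero ω, ?_⟩
      have := natCast_add_one_le (K := K) hnm
      rw [natCast_zero]
      rw [natCast_succ] at *
      linarith

theorem IsInt.one_le {x : K} (hx : IsInt ω x) (h0 : 0 < x) : 1 ≤ x := by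
  obtain ⟨n, rfl⟩ := hx.exists_natCast_eq h0.le
  have h : zero ω < n := by
    rcases (zero_le n).lt_or_eq with h | rfl
    · exact h
    · simp at h0
  simpa using natCast_add_one_le (K := K) h

theorem IsInt.eq_of_abs_lt {x y : K} (hx : IsInt ω x) (hy : IsInt ω y) (h1 : x < y + 1)
    (h2 : y < x + 1) : x = y := by
  rcases lt_trichotomy x y with h | h | h
  · linarith [(hy.sub hx).one_le (sub_pos.2 h)]
  · exact h
  · linarith [(hx.sub hy).one_le (sub_pos.2 h)]

variable (ω) in
theorem exists_floor [ISupClosed M K] (x : K) : ∃ z : K, IsInt ω z ∧ z ≤ x ∧ x < z + 1 := by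
  have pos : ∀ y : K, 0 ≤ y → ∃ n : El ω, natCast ω K n ≤ y ∧ y < natCast ω K n + 1 := by
    intro y hy
    obtain ⟨n, hn, hmin⟩ := exists_least (P := fun n : El ω => y < natCast ω K n + 1) by_dfn (by
      obtain ⟨n, hn⟩ := exists_lt_natCast ω y
      exact ⟨n, by linarith⟩)
    refine ⟨n, ?_, hn⟩
    by_contra! hc
    have h : zero ω < n := by
      rcases (zero_le n).lt_or_eq with h | rfl
      · exact h
      · simp only [natCast_zero] at hc
        linarith
    obtain ⟨k, rfl⟩ : ∃ k, n = succ k := by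
      revert h
      exact induction (P := fun n : El ω => zero ω < n → ∃ k, n = succ k)
        (Dfn.imp by_dfn (Dfn.ex (Dfn.eq by_dfn (dfnF_succ by_dfn))))
        (fun h => (lt_irrefl _ h).elim) (fun k _ _ => ⟨k, rfl⟩) n
    rw [natCast_succ] at hc
    exact absurd (hmin k hc) (lt_succ_self k).not_ge
  obtain ⟨m, hm⟩ := exists_lt_natCast ω (-x)
  obtain ⟨n, hn, hn'⟩ := pos (x + natCast ω K m) (by linarith)
  exact ⟨natCast ω K n - natCast ω K m, ⟨n, m, rfl⟩, by linarith, by linarith⟩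

/-! ### Rational numbers of the model and their denominators -/

theorem dfn_isRat {Z : Type u} [Coded M Z] {f : Z → K} (hf : DfnF M f) :
    Dfn M fun z => IsRat M (f z) := by
  refine Dfn.comp (P := fun x : K => IsRat M x) ?_ hf
  -- The axioms of a subfield, written with quantifiers over `K`. Closure under inverses is phrased
  -- by `a * b = 1`, which avoids inversion and the convention for `0⁻¹`.
  have h : Dfn M fun x : K => ∀ S : ISet M K, ((0 : K) ∈ S ∧ (1 : K) ∈ S ∧
      (∀ a, a ∈ S → ∀ b, b ∈ S → a + b ∈ S) ∧ (∀ a, a ∈ S → ∀ b, b ∈ S → a * b ∈ S) ∧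
      (∀ a, a ∈ S → -a ∈ S) ∧ (∀ a, a ∈ S → ∀ b, a * b = 1 → b ∈ S)) → x ∈ S := by_dfn
  refine h.congr fun x => ⟨?_, ?_⟩
  · rintro hx S ⟨h0, h1, ha, hm, hn, hi⟩
    let L : Subfield K :=
      { carrier := {x | x ∈ S}
        zero_mem' := h0
        one_mem' := h1
        add_mem' := fun {a b} hx hy => ha a hx b hy
        mul_mem' := fun {a b} hx hy => hm a hx b hy
        neg_mem' := fun {a} hx => hn a hx
        inv_mem' := fun a hx => by
          by_cases h : a = 0
          · simpa [h] using h0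
          · exact hi a hx _ (mul_inv_cancel₀ h) }
    exact hx L S.dfn
  · intro hx L hL
    refine hx (ISet.of M (fun x => x ∈ L) hL) ⟨L.zero_mem, L.one_mem, fun a ha b hb => L.add_mem ha hb,
      fun a ha b hb => L.mul_mem ha hb, fun a ha => L.neg_mem ha, fun a ha b hb => ?_⟩
    rw [eq_comm] at hb
    have hb' : b = a⁻¹ := eq_inv_of_mul_eq_one_right hb.symm
    rw [hb']
    exact L.inv_mem ha

theorem _root_.SetModel.IsRat.sub {x y : K} (hx : IsRat M x) (hy : IsRat M y) : IsRat M (x - y) :=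
  fun S hS => S.sub_mem (hx S hS) (hy S hS)

theorem _root_.SetModel.IsRat.add {x y : K} (hx : IsRat M x) (hy : IsRat M y) : IsRat M (x + y) :=
  fun S hS => S.add_mem (hx S hS) (hy S hS)

theorem isRat_natCast (n : El ω) : IsRat M (natCast ω K n) := by
  intro S hS
  refine induction (P := fun n : El ω => natCast ω K n ∈ S) (hS.comp by_dfn) ?_ ?_ n
  · rw [natCast_zero]
    exact S.zero_mem
  · intro n ih
    rw [natCast_succ]
    exact S.add_mem ih S.one_mem

theorem IsInt.isRat {x : K} (hx : IsInt ω x) : IsRat M x := by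
  obtain ⟨m, n, rfl⟩ := hx
  exact (isRat_natCast m).sub (isRat_natCast n)

variable (ω) in
-- Fractions of integers form a definable subfield, so it contains every rational. Writing the
-- denominator as a successor keeps it positive.
theorem _root_.SetModel.IsRat.exists_mul_eq {x : K} (hx : IsRat M x) :
    ∃ (a : K) (n : El ω), IsInt ω a ∧ x * natCast ω K (succ n) = a := by
  let L : Subfield K :=
    { carrier := {x | ∃ a b : K, IsInt ω a ∧ IsInt ω b ∧ b ≠ 0 ∧ x * b = a}
      zero_mem' := ⟨0, 1, isInt_zero, isInt_one, one_ne_zero, by ring⟩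
      one_mem' := ⟨1, 1, isInt_one, isInt_one, one_ne_zero, by ring⟩
      add_mem' := by
        rintro x y ⟨a, b, ha, hb, h0, rfl⟩ ⟨c, d, hc, hd, h0', rfl⟩
        exact ⟨_, b * d, (ha.mul hd).add (hc.mul hb), hb.mul hd, mul_ne_zero h0 h0', by ring⟩
      mul_mem' := by
        rintro x y ⟨a, b, ha, hb, h0, rfl⟩ ⟨c, d, hc, hd, h0', rfl⟩
        exact ⟨_, b * d, ha.mul hc, hb.mul hd, mul_ne_zero h0 h0', by ring⟩
      neg_mem' := by
        rintro x ⟨a, b, ha, hb, h0, rfl⟩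
        exact ⟨_, b, ha.neg, hb, h0, by ring⟩
      inv_mem' := by
        rintro x ⟨a, b, ha, hb, h0, rfl⟩
        by_cases hx : x = 0
        · exact ⟨0, 1, isInt_zero, isInt_one, one_ne_zero, by simp [hx]⟩
        · exact ⟨b, x * b, hb, ha, mul_ne_zero hx h0, by field_simp⟩ }
  obtain ⟨a, b, ha, hb, h0, h⟩ := hx L (by
    refine Dfn.ex (Dfn.ex (Dfn.and (dfn_isInt by_dfn) (Dfn.and (dfn_isInt by_dfn) by_dfn))))
  have main : ∀ a b : K, IsInt ω a → IsInt ω b → 0 < b → x * b = a →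
      ∃ (a : K) (n : El ω), IsInt ω a ∧ x * natCast ω K (succ n) = a := by
    intro a b ha hb hb0 h
    obtain ⟨n, hn⟩ := (hb.sub isInt_one).exists_natCast_eq (sub_nonneg.2 (hb.one_le hb0))
    exact ⟨a, n, ha, by rw [natCast_succ, ← hn, ← h]; ring⟩
  rcases lt_or_gt_of_ne h0 with h0 | h0
  · exact main (-a) (-b) ha.neg hb.neg (neg_pos.2 h0) (by rw [← h]; ring)
  · exact main a b ha hb h0 h

/-! ### Factorials and digits -/

theorem exists_factorial : ∃ f : IFun M (El ω) K, f (zero ω) = 1 ∧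
    ∀ n, f (succ n) = f n * (natCast ω K n + 1) :=
  exists_rec (F := fun n x => x * (natCast ω K n + 1)) by_dfn 1

variable (ω K) in
/-- The factorials of the natural numbers of the model. -/
noncomputable def factorial : IFun M (El ω) K := exists_factorial.choose

@[simp] theorem factorial_zero : factorial ω K (zero ω) = 1 := exists_factorial.choose_spec.1

@[simp] theorem factorial_succ (n : El ω) :
    factorial ω K (succ n) = factorial ω K n * (natCast ω K n + 1) :=
  exists_factorial.choose_spec.2 n

theorem isInt_factorial (n : El ω) : IsInt ω (factorial ω K n) := by
  refine induction (P := fun n : El ω => IsInt ω (factorial ω K n)) (dfn_isInt by_dfn) ?_ ?_ n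
  · simpa using isInt_one
  · intro n ih
    rw [factorial_succ]
    exact ih.mul ((isInt_natCast n).add isInt_one)

theorem natCast_le_factorial (n : El ω) : 1 ≤ factorial ω K n ∧ natCast ω K n ≤ factorial ω K n := by
  refine induction (P := fun n : El ω => 1 ≤ factorial ω K n ∧ natCast ω K n ≤ factorial ω K n)
    by_dfn (by simp) ?_ n
  rintro n ⟨h1, h2⟩
  have := natCast_nonneg (K := K) n
  rw [factorial_succ, natCast_succ]
  constructor <;> nlinarith

/-- If `x` has denominator `m + 1`, then this number divides `n!` for all `n ≥ m + 1`. -/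
theorem isInt_factorial_mul_of_isRat {x : K} (hx : IsRat M x) :
    ∃ n₀ : El ω, ∀ n, n₀ ≤ n → IsInt ω (factorial ω K n * x) := by
  obtain ⟨a, m, ha, h⟩ := hx.exists_mul_eq ω
  refine ⟨succ m, fun n => ?_⟩
  refine induction (P := fun n : El ω => succ m ≤ n → IsInt ω (factorial ω K n * x))
    (Dfn.imp by_dfn (dfn_isInt by_dfn)) ?_ ?_ n
  · exact fun h => (not_lt_zero _ ((lt_succ_self m).trans_le h)).elim
  · intro n ih hn
    rcases hn.lt_or_eq with hn | hn
    · have e : factorial ω K (succ n) * x = factorial ω K n * x * (natCast ω K n + 1) := by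
        rw [factorial_succ]; ring
      rw [e]
      exact (ih (lt_succ_iff.1 hn)).mul ((isInt_natCast n).add isInt_one)
    · have e : factorial ω K (succ n) * x = factorial ω K n * a := by
        rw [← h, hn, factorial_succ, natCast_succ]; ring
      rw [e]
      exact (isInt_factorial n).mul ha

/-- The fractional part of `n! * x` is less than `j / (n + 1)`. -/
def Digit (n j : El ω) (x : K) : Prop :=
  ∃ z : K, IsInt ω z ∧ z ≤ factorial ω K n * x ∧
    (natCast ω K n + 1) * (factorial ω K n * x - z) < natCast ω K j

theorem dfn_digit {Z : Type u} [Coded M Z] {f g : Z → El ω} {h : Z → K} (hf : DfnF M f)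
    (hg : DfnF M g) (hh : DfnF M h) : Dfn M fun z => Digit (f z) (g z) (h z) :=
  Dfn.ex (Dfn.and (dfn_isInt by_dfn) (Dfn.and
    (Dfn.le by_dfn (DfnF.mul (DfnF.app by_dfn (hf.comp by_dfn)) (hh.comp by_dfn)))
    (Dfn.lt (DfnF.mul (DfnF.add (DfnF.app by_dfn (hf.comp by_dfn)) by_dfn)
      (DfnF.sub (DfnF.mul (DfnF.app by_dfn (hf.comp by_dfn)) (hh.comp by_dfn)) by_dfn))
      (DfnF.app by_dfn (hg.comp by_dfn)))))

theorem Digit.of_isInt_sub {n j : El ω} {x y : K} (h : Digit n j x)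
    (hxy : IsInt ω (factorial ω K n * (y - x))) : Digit n j y := by
  obtain ⟨z, hz, h1, h2⟩ := h
  refine ⟨z + factorial ω K n * (y - x), hz.add hxy, by linarith, ?_⟩
  have e : factorial ω K n * y - (z + factorial ω K n * (y - x)) = factorial ω K n * x - z := by ring
  rwa [e]

/-- From some `n` on, `n! * (x - y)` is an integer, so `n! * x` and `n! * y` have the same
fractional part. -/
theorem digit_iff_of_isRat_sub {x y : K} (h : IsRat M (x - y)) :
    ∃ n₀ : El ω, ∀ n, n₀ ≤ n → ∀ j : El ω, Digit n j x ↔ Digit n j y := by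
  obtain ⟨n₀, hn₀⟩ := isInt_factorial_mul_of_isRat (ω := ω) h
  refine ⟨n₀, fun n hn j => ⟨fun h => h.of_isInt_sub ?_, fun h => h.of_isInt_sub (hn₀ n hn)⟩⟩
  have := (hn₀ n hn).neg
  rwa [← mul_neg, neg_sub] at this

/-- By induction, `n! * x` and `n! * y` have the same integer part for every `n`. Thus `x` and `y`
differ by less than `1 / n!`, and these bounds tend to zero. -/
theorem eq_of_digit_iff [ISupClosed M K] {x y : K} (hx0 : 0 ≤ x) (hx1 : x < 1) (hy0 : 0 ≤ y)
    (hy1 : y < 1) (h : ∀ n j : El ω, j ≤ succ n → (Digit n j x ↔ Digit n j y)) : x = y := by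
  have key : ∀ n : El ω, ∃ z : K, IsInt ω z ∧ (z ≤ factorial ω K n * x ∧
      factorial ω K n * x < z + 1) ∧ z ≤ factorial ω K n * y ∧ factorial ω K n * y < z + 1 := by
    refine induction (P := fun n : El ω => ∃ z : K, IsInt ω z ∧ (z ≤ factorial ω K n * x ∧
      factorial ω K n * x < z + 1) ∧ z ≤ factorial ω K n * y ∧ factorial ω K n * y < z + 1)
      (Dfn.ex (Dfn.and (dfn_isInt by_dfn) by_dfn)) ?_ ?_
    · exact ⟨0, isInt_zero, by simp [*], by simp [*]⟩
    · rintro n ⟨z, hz, ⟨x1, x2⟩, y1, y2⟩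
      have hn := natCast_nonneg (K := K) n
      -- the digit of a point with integer part `z`
      have digit : ∀ t : K, z ≤ factorial ω K n * t → factorial ω K n * t < z + 1 → ∀ j : El ω,
          j ≤ succ n → (Digit n j t ↔
            (natCast ω K n + 1) * (factorial ω K n * t - z) < natCast ω K j) := by
        intro t t1 t2 j hj
        refine ⟨?_, fun h => ⟨z, hz, t1, h⟩⟩
        rintro ⟨w, hw, h1, h2⟩
        have hj' : natCast ω K j ≤ natCast ω K n + 1 := by
          rw [← natCast_succ]
          exact natCast_le_natCast.2 hj
        -- The bound `j ≤ n + 1` is used here: it forces the integer `w` in `Digit` to be the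
        -- integer part `z`.
        have h3 : factorial ω K n * t - w < 1 := by
          by_contra! hc
          nlinarith
        obtain rfl : w = z := hw.eq_of_abs_lt hz (by linarith) (by linarith)
        exact h2
      -- The next digit of `x`. It is pinned down for `y` by the two thresholds `j` and `j + 1`, and
      -- the new integer part is `(n + 1) * z + j`.
      obtain ⟨i, hi, i1, i2⟩ := exists_floor ω ((natCast ω K n + 1) * (factorial ω K n * x - z))
      have hi0 : 0 ≤ i := by
        by_contra! hc
        have := hi.neg.one_le (by linarith)
        nlinarith
      obtain ⟨j, rfl⟩ := hi.exists_natCast_eq hi0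
      have hj : j < succ n := by
        rw [← not_le, ← natCast_le_natCast (K := K), natCast_succ, not_le]
        nlinarith
      have a1 := (h n (succ j) (succ_le_of_lt hj)).1 ((digit x x1 x2 _ (succ_le_of_lt hj)).2
        (by rw [natCast_succ]; exact i2))
      rw [digit y y1 y2 _ (succ_le_of_lt hj), natCast_succ] at a1
      have a2 : ¬ Digit n j y := by
        rw [← h n j hj.le, digit x x1 x2 j hj.le, not_lt]
        exact i1
      rw [digit y y1 y2 j hj.le, not_lt] at a2
      refine ⟨(natCast ω K n + 1) * z + natCast ω K j, (((isInt_natCast n).add isInt_one).mul hz).add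
        (isInt_natCast j), ?_, ?_⟩ <;> rw [factorial_succ] <;> constructor <;> nlinarith
  have small : ∀ d : K, 0 < d → ∃ n : El ω, 1 ≤ factorial ω K n * d := by
    intro d hd
    obtain ⟨n, hn⟩ := exists_lt_natCast ω d⁻¹
    refine ⟨n, ?_⟩
    have h1 := (natCast_le_factorial (K := K) n).2
    have h2 : d⁻¹ * d = 1 := inv_mul_cancel₀ hd.ne'
    nlinarith
  rcases lt_trichotomy x y with hxy | hxy | hxy
  · obtain ⟨n, hn⟩ := small _ (sub_pos.2 hxy)
    obtain ⟨z, -, ⟨_, _⟩, _, _⟩ := key n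
    nlinarith
  · exact hxy
  · obtain ⟨n, hn⟩ := small _ (sub_pos.2 hxy)
    obtain ⟨z, -, ⟨_, _⟩, _, _⟩ := key n
    nlinarith

variable (ω) in
/-- A sequence of positive numbers that converges to zero geometrically. -/
theorem exists_halving [ISupClosed M K] : ∃ e : IFun M (El ω) K, (∀ n, 0 < e n) ∧
    (∀ n, e (succ n) = e n / 2) ∧ ∀ δ, 0 < δ → ∃ N, ∀ n, N ≤ n → e n < δ := by
  obtain ⟨e, h0, hs⟩ := exists_rec (ω := ω) (F := fun (_ : El ω) (x : K) => x * 2⁻¹) by_dfn 1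
  -- The sequence is `2⁻ⁿ`; the bound by `1 / (n + 1)` reduces its convergence to the Archimedean
  -- property.
  have key : ∀ n, 0 < e n ∧ e n * (natCast ω K n + 1) ≤ 1 := by
    refine induction (P := fun n => 0 < e n ∧ e n * (natCast ω K n + 1) ≤ 1) by_dfn (by simp [h0]) ?_
    rintro n ⟨h1, h2⟩
    have := natCast_nonneg (K := K) n
    rw [hs, natCast_succ]
    constructor
    · positivity
    · nlinarith
  refine ⟨e, fun n => (key n).1, fun n => (hs n).trans (div_eq_mul_inv _ _).symm, fun δ hδ => ?_⟩
  obtain ⟨N, hN⟩ := exists_lt_natCast ω δ⁻¹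
  refine ⟨N, fun n hn => ?_⟩
  have h1 := natCast_le_natCast (K := K) |>.2 hn
  have h2 := (key n).2
  have h3 := (key n).1
  have h4 : δ⁻¹ * δ = 1 := inv_mul_cancel₀ hδ.ne'
  have h5 : 0 < δ⁻¹ := inv_pos.2 hδ
  by_contra! hc
  have h6 : δ * (natCast ω K n + 1) ≤ 1 := by nlinarith
  nlinarith

end RealLine

end

section

variable {M : Type u} [Membership M M] [ZFDC M]

open Coded Omega RealLine

variable {ω : M} [hω : Fact (IsOmega ω)]
variable {K : Type u} [Coded M K] [Small M K] [Field K] [LinearOrder K] [IsStrictOrderedRing K]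
  [DfnAdd M K] [DfnMul M K] [DfnLE M K]
variable {Γ : Type u} [Coded M Γ] [Small M Γ] [Group Γ] [DfnMul M Γ] [TopologicalSpace Γ]
variable {D : IFun M (Γ × Γ) K}
variable {W : Type u} [Coded M W] [Small M W]

/-! ## Functions with finite range -/

/-- The function takes finitely many values, all in `H`. -/
def FinRange (H : Subgroup Γ) (p : IFun M W Γ) : Prop :=
  ∃ P : ISet M Γ, IFin P ∧ (∀ g, g ∈ P → g ∈ H) ∧ ∀ x, p x ∈ P

theorem dfn_finRange (H : Subgroup Γ) [DfnSubgroup M H] {Z : Type u} [Coded M Z]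
    {f : Z → IFun M W Γ} (hf : DfnF M f) : Dfn M fun z => FinRange H (f z) :=
  Dfn.comp (P := fun p : IFun M W Γ => FinRange H p)
    (Dfn.ex (Dfn.and (IFin.dfn by_dfn) by_dfn)) hf

/-- Left multiplication by `g` need not be uniformly small on the group, but over finitely many
points a minimum of radii works. This is why the approximating maps must have finite range. -/
theorem exists_uniform_mul_left [IsTopologicalGroup Γ] (hD : IsCompatibleMetric D) {P : ISet M Γ}
    (hP : IFin P) {ε : K} (hε : 0 < ε) :
    ∃ δ : K, 0 < δ ∧ ∀ g, D (1, g) < δ → ∀ q, q ∈ P → D (q, g * q) < ε := by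
  refine IFin.induction (P := fun P : ISet M Γ => ∃ δ : K, 0 < δ ∧ ∀ g, D (1, g) < δ →
    ∀ q, q ∈ P → D (q, g * q) < ε) by_dfn ?_ ?_ hP
  · exact fun T hT => ⟨1, one_pos, fun g _ q hq => (hT q hq).elim⟩
  · rintro T - ⟨δ, hδ, h⟩ a T' e
    have hc : Filter.Tendsto (fun g => g * a) (nhds 1) (nhds a) := by
      have : Continuous fun g => g * a := by fun_prop
      simpa using this.tendsto 1
    obtain ⟨δ', hδ', h'⟩ := ((hD.basis 1).tendsto_left_iff).1 hc _ (hD.ball_mem a hε)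
    refine ⟨min δ δ', lt_min hδ hδ', fun g hg q hq => ?_⟩
    rcases (e q).1 hq with rfl | hq
    · exact h' (hg.trans_le (min_le_right _ _))
    · exact h g (hg.trans_le (min_le_left _ _)) q hq

/-- Splitting a finite-range function along one set. -/
theorem exists_split [IsTopologicalGroup Γ] (hD : IsCompatibleMetric D)
    (F : Subgroup Γ) [DfnSubgroup M F] (hinf : ¬ ∃ Y : ISet M Γ, IFin Y ∧
      ∀ h, h ∈ F.topologicalClosure → ∃ y, y ∈ Y ∧ y⁻¹ * h ∈ F)
    {p : IFun M W Γ} (hp : FinRange F.topologicalClosure p) (b : ISet M W) {ε : K} (hε : 0 < ε) :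
    ∃ p' : IFun M W Γ, FinRange F.topologicalClosure p' ∧ (∀ x, D (p x, p' x) < ε) ∧
      (∀ x y, (x ∈ b ↔ y ∈ b) → (p' x)⁻¹ * p' y = (p x)⁻¹ * p y) ∧
      ∀ x y, (p' x)⁻¹ * p' y ∈ F → (x ∈ b ↔ y ∈ b) ∧ (p x)⁻¹ * p y ∈ F := by
  classical
  obtain ⟨P, hP, hPH, hpP⟩ := hp
  obtain ⟨δ, hδ, hδ'⟩ := exists_uniform_mul_left hD hP hε
  -- The new map is `g * p` on `b` and `p` elsewhere. On one side of `b` the quotients are unchanged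
  -- since `g` cancels; across the two sides they avoid `F` since `g` moves the range `P` off `P F`.
  obtain ⟨g, hgH, hg, hgF⟩ := exists_displacement hD F hinf hP hPH hP hPH hδ
  obtain ⟨Q, hQ, hQ'⟩ := hP.exists_image (IFun.of M (fun q => g * q) by_dfn)
  obtain ⟨U, hU, hU'⟩ := hP.exists_union hQ
  have hval : ∀ x, x ∈ b → IFun.of M (fun x => if x ∈ b then g * p x else p x) by_dfn x = g * p x :=
    fun x hx => if_pos hx
  have hval' : ∀ x, ¬ x ∈ b → IFun.of M (fun x => if x ∈ b then g * p x else p x) by_dfn x = p x :=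
    fun x hx => if_neg hx
  refine ⟨IFun.of M (fun x => if x ∈ b then g * p x else p x) by_dfn, ⟨U, hU, fun u hu => ?_,
    fun x => ?_⟩, fun x => ?_, fun x y h => ?_, fun x y h => ?_⟩
  · rcases (hU' u).1 hu with hu | hu
    · exact hPH u hu
    · obtain ⟨q, hq, rfl⟩ := (hQ' u).1 hu
      exact mul_mem hgH (hPH q hq)
  · by_cases hx : x ∈ b
    · rw [hval x hx]
      exact (hU' _).2 (Or.inr ((hQ' _).2 ⟨_, hpP x, rfl⟩))
    · rw [hval' x hx]
      exact (hU' _).2 (Or.inl (hpP x))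
  · by_cases hx : x ∈ b
    · rw [hval x hx]
      exact hδ' g hg _ (hpP x)
    · rw [hval' x hx, hD.self]
      exact hε
  · by_cases hx : x ∈ b
    · rw [hval x hx, hval y (h.1 hx)]
      group
    · rw [hval' x hx, hval' y (mt h.2 hx)]
  · by_cases hx : x ∈ b <;> by_cases hy : y ∈ b
    · rw [hval x hx, hval y hy] at h
      exact ⟨by simp [hx, hy], by simpa [mul_assoc] using h⟩
    · rw [hval x hx, hval' y hy] at h
      refine (hgF _ (hpP x) _ (hpP y) ?_).elim
      have := F.inv_mem h
      simpa [mul_assoc] using this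
    · rw [hval' x hx, hval y hy] at h
      refine (hgF _ (hpP y) _ (hpP x) ?_).elim
      simpa [mul_assoc] using h
    · rw [hval' x hx, hval' y hy] at h
      exact ⟨by simp [hx, hy], h⟩

/-- Splitting a finite-range function along finitely many sets. -/
theorem exists_split_many [IsTopologicalGroup Γ] (hD : IsCompatibleMetric D)
    (F : Subgroup Γ) [DfnSubgroup M F] (hinf : ¬ ∃ Y : ISet M Γ, IFin Y ∧
      ∀ h, h ∈ F.topologicalClosure → ∃ y, y ∈ Y ∧ y⁻¹ * h ∈ F)
    {p : IFun M W Γ} (hp : FinRange F.topologicalClosure p) (B : ISet M (El ω × W)) (k : El ω)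
    {ε : K} (hε : 0 < ε) :
    ∃ p' : IFun M W Γ, FinRange F.topologicalClosure p' ∧ (∀ x, D (p x, p' x) < ε) ∧
      (∀ x y, (∀ j, j < k → ((j, x) ∈ B ↔ (j, y) ∈ B)) → (p' x)⁻¹ * p' y = (p x)⁻¹ * p y) ∧
      ∀ x y, (p' x)⁻¹ * p' y ∈ F → (∀ j, j < k → ((j, x) ∈ B ↔ (j, y) ∈ B)) ∧
        (p x)⁻¹ * p y ∈ F := by
  have := hD.dfnSubgroup_closure F
  refine induction (P := fun k : El ω => ∀ ε : K, 0 < ε → ∃ p' : IFun M W Γ,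
      FinRange F.topologicalClosure p' ∧ (∀ x, D (p x, p' x) < ε) ∧
      (∀ x y, (∀ j, j < k → ((j, x) ∈ B ↔ (j, y) ∈ B)) → (p' x)⁻¹ * p' y = (p x)⁻¹ * p y) ∧
      ∀ x y, (p' x)⁻¹ * p' y ∈ F → (∀ j, j < k → ((j, x) ∈ B ↔ (j, y) ∈ B)) ∧
        (p x)⁻¹ * p y ∈ F)
    (Dfn.all (Dfn.imp by_dfn (Dfn.ex (Dfn.and (dfn_finRange _ by_dfn) by_dfn)))) ?_ ?_ k ε hε
  · exact fun ε hε => ⟨p, hp, fun x => by rwa [hD.self], fun x y _ => rfl,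
      fun x y h => ⟨fun j hj => (not_lt_zero j hj).elim, h⟩⟩
  · intro k ih ε hε
    obtain ⟨q, hq, q1, q2, q3⟩ := ih (ε / 2) (half_pos hε)
    obtain ⟨r, hr, r1, r2, r3⟩ := exists_split hD F hinf hq (ISet.of M (fun x => (k, x) ∈ B) by_dfn)
      (half_pos hε)
    refine ⟨r, hr, fun x => ?_, fun x y h => ?_, fun x y h => ?_⟩
    · linarith [hD.triangle (p x) (q x) (r x), q1 x, r1 x]
    · rw [r2 x y (h k (lt_succ_self k)), q2 x y fun j hj => h j (hj.trans (lt_succ_self k))]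
    · obtain ⟨h1, h2⟩ := r3 x y h
      obtain ⟨h3, h4⟩ := q3 x y h2
      refine ⟨fun j hj => ?_, h4⟩
      rcases (lt_succ_iff.1 hj).lt_or_eq with hj | rfl
      · exact h3 j hj
      · exact h1

/-! ## Limits -/

/-- Convergence of a sequence of the model. -/
def ConvergesTo (D : IFun M (Γ × Γ) K) (s : IFun M (El ω) Γ) (x : Γ) : Prop :=
  ∀ ε : K, 0 < ε → ∃ N : El ω, ∀ n : El ω, N < n → D (s n, x) < ε

variable (ω) in
/-- Cauchy sequences of the model converge. -/
def IsCauchyComplete (D : IFun M (Γ × Γ) K) : Prop :=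
  ∀ s : IFun M (El ω) Γ,
    (∀ ε : K, 0 < ε → ∃ N : El ω, ∀ m n : El ω, N < m → N < n → D (s m, s n) < ε) →
    ∃ x, ConvergesTo D s x

/-- Right multiplication by `a` is continuous. Applied to two sequences with eventually constant
quotient `a`, this shows that their limits have the same quotient. -/
theorem ConvergesTo.mul_right_eq [IsTopologicalGroup Γ] (hD : IsCompatibleMetric D)
    {s t : IFun M (El ω) Γ} {x y a : Γ} (hs : ConvergesTo D s x) (ht : ConvergesTo D t y)
    {N : El ω} (h : ∀ n, N ≤ n → s n * a = t n) : x * a = y := by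
  by_contra hne
  have hpos : 0 < D (x * a, y) := by
    have h1 := (hD.eq_zero_iff (x * a) y).not.2 hne
    have h2 := hD.triangle (x * a) y (x * a)
    rw [hD.self, hD.symm y] at h2
    exact lt_of_le_of_ne (by linarith) (Ne.symm h1)
  have hc : Filter.Tendsto (fun g => g * a) (nhds x) (nhds (x * a)) := by
    have : Continuous fun g => g * a := by fun_prop
    exact this.tendsto x
  obtain ⟨δ, hδ, hδ'⟩ := ((hD.basis x).tendsto_left_iff).1 hc _ (hD.ball_mem _ (half_pos hpos))
  obtain ⟨N₁, h₁⟩ := hs δ hδ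
  obtain ⟨N₂, h₂⟩ := ht _ (half_pos hpos)
  let n := succ (max N (max N₁ N₂))
  have hn : max N (max N₁ N₂) < n := lt_succ_self _
  have k0 : N ≤ n := (le_max_left _ _).trans hn.le
  have k1 : N₁ < n := ((le_max_left _ _).trans (le_max_right _ _)).trans_lt hn
  have k2 : N₂ < n := ((le_max_right _ _).trans (le_max_right _ _)).trans_lt hn
  have e1 : D (x * a, s n * a) < D (x * a, y) / 2 := hδ' (show D (x, s n) < δ from
    hD.symm x _ ▸ h₁ n k1)
  rw [h n k0] at e1
  linarith [h₂ n k2, hD.triangle (x * a) (t n) y]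

theorem ConvergesTo.unique [IsTopologicalGroup Γ] (hD : IsCompatibleMetric D)
    {s : IFun M (El ω) Γ} {x y : Γ} (hx : ConvergesTo D s x) (hy : ConvergesTo D s y) : x = y := by
  simpa using ConvergesTo.mul_right_eq hD (a := 1) (N := zero ω) hx hy fun n _ => mul_one _

/-- A sequence whose steps are bounded by a halving sequence is Cauchy. -/
theorem cauchy_of_halving (hD : IsCompatibleMetric D) {e : IFun M (El ω) K} (he : ∀ n, 0 < e n)
    (hs : ∀ n, e (succ n) = e n / 2) (h0 : ∀ δ, 0 < δ → ∃ N, ∀ n, N ≤ n → e n < δ)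
    {s : IFun M (El ω) Γ} (h : ∀ n, D (s n, s (succ n)) < e n) (ε : K) (hε : 0 < ε) :
    ∃ N : El ω, ∀ m n : El ω, N < m → N < n → D (s m, s n) < ε := by
  -- The sum of `e i` over `m ≤ i < n` telescopes to `2 * e m - 2 * e n`.
  have key : ∀ m n : El ω, m ≤ n → D (s m, s n) ≤ 2 * e m - 2 * e n := by
    intro m n
    refine induction (P := fun n => m ≤ n → D (s m, s n) ≤ 2 * e m - 2 * e n) by_dfn ?_ ?_ n
    · intro hm
      obtain rfl := hm.antisymm (zero_le m)
      rw [hD.self]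
      linarith
    · intro n ih hm
      rcases hm.lt_or_eq with hm | rfl
      · rw [hs]
        linarith [ih (lt_succ_iff.1 hm), h n, hD.triangle (s m) (s n) (s (succ n))]
      · rw [hD.self]
        linarith
  obtain ⟨N, hN⟩ := h0 (ε / 4) (by linarith)
  refine ⟨N, fun m n hm hn => ?_⟩
  linarith [hD.triangle (s m) (s N) (s n), key N m hm.le, key N n hn.le, hD.symm (s m) (s N),
    he m, he n, hN N le_rfl]

/-! ## The Vitali set -/

/-- The digit sets are separated by maps of finite range whose limit `φ` takes distinct points of
`[0, 1)` with rational difference to distinct cosets of `F`. The set selects from each class the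
point of `[0, 1)` whose image has least index under `κ`. -/
theorem exists_vitali [IsTopologicalGroup Γ] [ISupClosed M K] (hD : IsCompatibleMetric D)
    (hC : IsCauchyComplete ω D) (F : Subgroup Γ) [DfnSubgroup M F]
    (κ : IFun M Γ (El ω)) (hκ : ∀ g h, κ g = κ h → g⁻¹ * h ∈ F)
    (hinf : ¬ ∃ Y : ISet M Γ, IFin Y ∧ ∀ h, h ∈ F.topologicalClosure → ∃ y, y ∈ Y ∧ y⁻¹ * h ∈ F) :
    ∃ T : ISet M K, ∀ x : K, ∃! t, t ∈ T ∧ IsRat M (t - x) := by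
  have := hD.dfnSubgroup_closure F
  obtain ⟨e, he, hes, he0⟩ := exists_halving (K := K) ω
  let B : ISet M (El ω × El ω × K) := ISet.of M (fun t => Digit t.1 t.2.1 t.2.2)
    (dfn_digit by_dfn by_dfn by_dfn)
  -- The condition `j < n + 2` means `j ≤ n + 1`, the range of thresholds needed in
  -- `eq_of_digit_iff`.
  let k : IFun M (El ω) (El ω) := IFun.of M (fun n => succ (succ n)) (dfnF_succ (dfnF_succ by_dfn))
  have hB : ∀ n j x, (n, j, x) ∈ B ↔ Digit n j x := fun _ _ _ => Iff.rfl
  have hk : ∀ n, k n = succ (succ n) := fun _ => rfl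
  clear_value B k
  obtain ⟨p, -, hp⟩ := exists_seq_from (ω := ω) (X := IFun M K Γ)
    (P := fun p => FinRange F.topologicalClosure p)
    (r := fun n p p' => (∀ x, D (p x, p' x) < e n) ∧
      (∀ x y, (∀ j, j < k n → ((n, j, x) ∈ B ↔ (n, j, y) ∈ B)) →
        (p' x)⁻¹ * p' y = (p x)⁻¹ * p y) ∧
      ∀ x y, (p' x)⁻¹ * p' y ∈ F → (∀ j, j < k n → ((n, j, x) ∈ B ↔ (n, j, y) ∈ B)) ∧
        (p x)⁻¹ * p y ∈ F) (dfn_finRange _ by_dfn) by_dfn (IFun.of M (fun _ => 1) by_dfn)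
    ⟨ISet.of M (fun g => g = 1) by_dfn, (IFin.of_empty (T := ISet.of M (fun _ => False) by_dfn)
      fun _ h => h).of_insert 1 fun x => (or_false _).symm.to_iff,
      fun g hg => (show g = 1 from hg) ▸ one_mem _, fun _ => rfl⟩
    (fun n p hp => exists_split_many hD F hinf hp (ISet.of M (fun t => (n, t.1, t.2) ∈ B) by_dfn) (k n)
      (he n))
  have hlim : ∀ x, ∃ y, ConvergesTo D (IFun.of M (fun n => p n x) by_dfn) y :=
    fun x => hC _ (cauchy_of_halving hD he hes he0 fun n => (hp n).2.1 x)
  choose φ hφ using hlim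
  have hφF : DfnF M φ := by
    refine DfnF.of_unique (P := fun x y => ∀ ε : K, 0 < ε → ∃ N : El ω, ∀ n : El ω, N < n →
      D (p n x, y) < ε) by_dfn fun x y => ⟨?_, fun h => (hφ x).unique hD h⟩
    rintro rfl
    exact hφ x
  -- agreement of digits
  have agree : ∀ x y, ∀ n : El ω, (p n x)⁻¹ * p n y ∈ F → ∀ m, m < n → ∀ j, j < k m →
      ((m, j, x) ∈ B ↔ (m, j, y) ∈ B) := by
    intro x y
    refine induction (P := fun n : El ω => (p n x)⁻¹ * p n y ∈ F → ∀ m, m < n → ∀ j, j < k m →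
      ((m, j, x) ∈ B ↔ (m, j, y) ∈ B)) by_dfn (fun _ m hm => (not_lt_zero m hm).elim) ?_
    intro n ih h m hm
    obtain ⟨h1, h2⟩ := (hp n).2.2.2 x y h
    rcases (lt_succ_iff.1 hm).lt_or_eq with hm | rfl
    · exact ih h2 m hm
    · exact h1
  -- Once the digits agree, the quotient of the values of `p n` no longer changes, and it passes to
  -- the limit.
  have tail : ∀ x y, IsRat M (x - y) → ∃ n₀ : El ω, ∀ n, n₀ ≤ n →
      (p n x)⁻¹ * p n y = (φ x)⁻¹ * φ y := by
    intro x y hxy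
    obtain ⟨n₀, hn₀⟩ := digit_iff_of_isRat_sub (ω := ω) hxy
    have h1 : ∀ n, n₀ ≤ n → (p n x)⁻¹ * p n y = (p n₀ x)⁻¹ * p n₀ y := by
      refine induction (P := fun n => n₀ ≤ n → (p n x)⁻¹ * p n y = (p n₀ x)⁻¹ * p n₀ y) by_dfn ?_ ?_
      · intro h
        rw [h.antisymm (zero_le _)]
      · intro n ih h
        rcases h.lt_or_eq with h | rfl
        · rw [(hp n).2.2.1 x y fun j _ => ?_, ih (lt_succ_iff.1 h)]
          rw [hB, hB]
          exact hn₀ n (lt_succ_iff.1 h) j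
        · rfl
    have h2 := (hφ x).mul_right_eq hD (hφ y) (a := (p n₀ x)⁻¹ * p n₀ y) (N := n₀) fun n hn => by
      rw [← h1 n hn]
      simp
    exact ⟨n₀, fun n hn => by rw [h1 n hn, ← h2]; simp⟩
  have inj : ∀ x y, 0 ≤ x → x < 1 → 0 ≤ y → y < 1 → IsRat M (x - y) → κ (φ x) = κ (φ y) → x = y := by
    intro x y hx0 hx1 hy0 hy1 hxy hκxy
    obtain ⟨n₀, hn₀⟩ := tail x y hxy
    refine eq_of_digit_iff (ω := ω) hx0 hx1 hy0 hy1 fun n j hj => ?_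
    rw [← hB, ← hB]
    -- The stage is late enough both for the quotient to have its limit value, which is in `F`, and
    -- to lie beyond digit `n`; `agree` then works back to that digit.
    have hmem : (p (max n₀ (succ n)) x)⁻¹ * p (max n₀ (succ n)) y ∈ F := by
      rw [hn₀ _ (le_max_left _ _)]
      exact hκ _ _ hκxy
    exact agree x y _ hmem n ((lt_succ_self n).trans_le (le_max_right _ _)) j
      (by rw [hk]; exact lt_succ_iff.2 hj)
  let c : IFun M K (El ω) := IFun.of M (fun x => κ (φ x)) (DfnF.app by_dfn hφF)
  have hc : ∀ x, c x = κ (φ x) := fun _ => rfl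
  clear_value c
  refine ⟨ISet.of M (fun t => (0 ≤ t ∧ t < 1) ∧ ∀ y, 0 ≤ y → y < 1 → IsRat M (y - t) → c t ≤ c y)
    (Dfn.and by_dfn (Dfn.all (Dfn.imp by_dfn (Dfn.imp by_dfn (Dfn.imp (dfn_isRat by_dfn) by_dfn))))),
    fun x => ?_⟩
  obtain ⟨n, ⟨t, ht0, ht1, htx, rfl⟩, hmin⟩ := exists_least (ω := ω)
    (P := fun n => ∃ t : K, 0 ≤ t ∧ t < 1 ∧ IsRat M (t - x) ∧ c t = n)
    (Dfn.ex (Dfn.and by_dfn (Dfn.and by_dfn (Dfn.and (dfn_isRat by_dfn) by_dfn)))) (by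
      -- The fractional part of `x` shows that its class meets `[0, 1)`.
      obtain ⟨z, hz, h1, h2⟩ := exists_floor ω x
      refine ⟨_, x - z, by linarith, by linarith, ?_, rfl⟩
      have : x - z - x = -z := by ring
      rw [this]
      exact hz.neg.isRat)
  refine ⟨t, ⟨⟨⟨ht0, ht1⟩, fun y hy0 hy1 hyt => hmin _ ⟨y, hy0, hy1, ?_, rfl⟩⟩, htx⟩, ?_⟩
  · have := hyt.add htx
    rwa [sub_add_sub_cancel] at this
  · rintro s ⟨⟨⟨hs0, hs1⟩, hs⟩, hsx⟩
    have hts : IsRat M (t - s) := by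
      have := htx.sub hsx
      rwa [sub_sub_sub_cancel_right] at this
    refine inj s t hs0 hs1 ht0 ht1 ?_ ?_
    · have := hsx.sub htx
      rwa [sub_sub_sub_cancel_right] at this
    · rw [← hc, ← hc]
      exact le_antisymm (hs t ht0 ht1 hts) (hmin _ ⟨s, hs0, hs1, hsx, rfl⟩)

end

section

variable {M : Type u} [Membership M M] [ZFDC M]

open Coded Omega RealLine

section

variable {ω : M} [hω : Fact (IsOmega ω)]
variable {K : Type u} [Coded M K] [Small M K] [Field K] [LinearOrder K] [IsStrictOrderedRing K]
  [DfnAdd M K] [DfnMul M K] [DfnLE M K]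
variable {Γ : Type u} [Coded M Γ] [Small M Γ] [Group Γ] [DfnMul M Γ] [TopologicalSpace Γ]
variable {D : IFun M (Γ × Γ) K}

/-! ## Baire category -/

/-- The closure of a subgroup of countable index is open. -/
theorem isOpen_topologicalClosure [IsTopologicalGroup Γ] [ISupClosed M K]
    (hD : IsCompatibleMetric D) (hC : IsCauchyComplete ω D) (F : Subgroup Γ) [DfnSubgroup M F]
    (κ : IFun M Γ (El ω)) (hκ : ∀ g h, κ g = κ h → g⁻¹ * h ∈ F) :
    IsOpen (F.topologicalClosure : Set Γ) := by
  by_contra hopen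
  obtain ⟨e, he, -, he0⟩ := exists_halving (K := K) ω
  -- An interior point of a coset of the closure would, after translation, make the closure open.
  have thin : ∀ g h : Γ, ∃ᶠ x in nhds h, g⁻¹ * x ∉ F.topologicalClosure := by
    intro g h hc
    replace hc : ∀ᶠ x in nhds h, g⁻¹ * x ∈ F.topologicalClosure := by
      simpa only [Filter.not_frequently, not_not] using hc
    refine hopen (Subgroup.isOpen_of_mem_nhds _ (g := g⁻¹ * h) ?_)
    have ht : Filter.Tendsto (fun x => g * x) (nhds (g⁻¹ * h)) (nhds h) := by
      have : Continuous fun x => g * x := by fun_prop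
      simpa using this.tendsto (g⁻¹ * h)
    filter_upwards [ht.eventually hc] with x hx
    rwa [inv_mul_cancel_left] at hx
  -- Nested balls are built as pairs (centre, radius); the closed ball obtained at step `n` misses
  -- the set of index `n`, which lies in a single coset of `F`.
  obtain ⟨s, -, hs⟩ := exists_seq_from (ω := ω) (X := Γ × K) (P := fun s => 0 < s.2)
    (r := fun n s t => D (s.1, t.1) + t.2 ≤ s.2 ∧ t.2 ≤ e n ∧
      ∀ h, D (t.1, h) ≤ t.2 → κ h ≠ n) by_dfn by_dfn (1, 1) one_pos (by
    rintro n ⟨x, ε⟩ (hε : 0 < ε)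
    -- a point with a neighbourhood that avoids the set of index `n`
    obtain ⟨x', δ, hx', hδ, hδ'⟩ : ∃ (x' : Γ) (δ : K), D (x, x') < ε ∧ 0 < δ ∧
        ∀ h, D (x', h) < δ → κ h ≠ n := by
      by_cases hall : ∀ h, D (x, h) < ε → κ h ≠ n
      · exact ⟨x, ε, by rwa [hD.self], hε, hall⟩
      push Not at hall
      obtain ⟨g, -, hgn⟩ := hall
      obtain ⟨x', hx', hxF⟩ := (Filter.frequently_iff.1 (thin g x)) (hD.ball_mem x hε)
      have hcl : {y | g⁻¹ * y ∉ F.topologicalClosure} ∈ nhds x' := by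
        have hc : Continuous fun y => g⁻¹ * y := by fun_prop
        exact ((F.isClosed_topologicalClosure.preimage hc).isOpen_compl).mem_nhds hxF
      obtain ⟨δ, hδ, hδ'⟩ := (hD.basis x').mem_iff.1 hcl
      exact ⟨x', δ, hx', hδ, fun h hh hn =>
        hδ' hh (F.le_topologicalClosure (hκ g h (hgn.trans hn.symm)))⟩
    have h1 : 0 < ε - D (x, x') := sub_pos.2 hx'
    refine ⟨(x', min (δ / 2) (min (e n) (ε - D (x, x')))), lt_min (half_pos hδ) (lt_min (he n) h1),
      ?_, (min_le_right _ _).trans (min_le_left _ _), fun h hh => hδ' h ?_⟩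
    · linarith [(min_le_right (δ / 2) (min (e n) (ε - D (x, x')))).trans (min_le_right _ _)]
    · exact hh.trans_lt ((min_le_left _ _).trans_lt (half_lt_self hδ)))
  have nest : ∀ m n : El ω, m ≤ n → D ((s m).1, (s n).1) + (s n).2 ≤ (s m).2 := by
    intro m n
    refine induction (P := fun n => m ≤ n → D ((s m).1, (s n).1) + (s n).2 ≤ (s m).2) by_dfn ?_ ?_ n
    · intro h
      rw [h.antisymm (zero_le m), hD.self, zero_add]
    · intro n ih h
      rcases h.lt_or_eq with h | rfl
      · linarith [ih (lt_succ_iff.1 h), (hs n).2.1,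
          hD.triangle (s m).1 (s n).1 (s (succ n)).1]
      · rw [hD.self, zero_add]
  obtain ⟨y, hy⟩ := hC (IFun.of M (fun n => (s n).1) by_dfn) (by
    intro ε hε
    obtain ⟨N, hN⟩ := he0 (ε / 2) (half_pos hε)
    refine ⟨N, fun m n hm hn => ?_⟩
    simp only [IFun.of_apply]
    linarith [nest _ _ (succ_le_of_lt hm), nest _ _ (succ_le_of_lt hn), (hs N).2.2.1, hN N le_rfl,
      (hs m).1, (hs n).1, hD.triangle (s m).1 (s (succ N)).1 (s n).1,
      hD.symm (s m).1 (s (succ N)).1])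
  -- The limit `y` lies in every closed ball, including the one that avoids its own index.
  refine (hs (κ y)).2.2.2 y ?_ rfl
  by_contra! hc
  obtain ⟨N, hN⟩ := hy _ (sub_pos.2 hc)
  let n := succ (max N (succ (κ y)))
  have hn : max N (succ (κ y)) < n := lt_succ_self _
  have h1 := hN n ((le_max_left _ _).trans_lt hn)
  simp only [IFun.of_apply] at h1
  linarith [nest _ n ((le_max_right _ _).trans hn.le), (hs n).1,
    hD.triangle (s (succ (κ y))).1 (s n).1 y]

end

/-! ## Finite sets are equinumerous with natural numbers -/

section

variable {ω : M} [hω : Fact (IsOmega ω)]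
variable {X Y : Type u} [Coded M X] [Small M X]

theorem IFin.subset {S : ISet M X} (hS : IFin S) {T : ISet M X} (hT : ∀ x, x ∈ T → x ∈ S) :
    IFin T := by
  refine IFin.induction (P := fun S : ISet M X => ∀ T : ISet M X, (∀ x, x ∈ T → x ∈ S) → IFin T)
    (Dfn.all (Dfn.imp by_dfn (IFin.dfn by_dfn))) ?_ ?_ hS T hT
  · exact fun S hS T hT => IFin.of_empty fun x hx => hS x (hT x hx)
  · intro S _ ih a S' e T hT
    have h1 : IFin (ISet.of M (fun x => x ∈ T ∧ x ≠ a) by_dfn) :=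
      ih _ fun x hx => ((e x).1 (hT x hx.1)).resolve_left hx.2
    by_cases ha : a ∈ T
    · refine h1.of_insert a fun x => ?_
      by_cases hx : x = a
      · simp [hx, ha]
      · simp [hx]
    · convert h1 using 1
      ext x
      exact ⟨fun hx => ⟨hx, fun h => ha (h ▸ hx)⟩, fun hx => hx.1⟩

variable (ω) in
-- Each new point receives the next free number. The function is defined on all of `X`, and its
-- values off `S` are irrelevant.
theorem IFin.exists_enumeration {S : ISet M X} (hS : IFin S) :
    ∃ (n : El ω) (f : IFun M X (El ω)), (∀ x, x ∈ S → f x < n) ∧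
      (∀ x y, x ∈ S → y ∈ S → f x = f y → x = y) ∧ ∀ i, i < n → ∃ x, x ∈ S ∧ f x = i := by
  classical
  refine IFin.induction (P := fun S : ISet M X => ∃ (n : El ω) (f : IFun M X (El ω)),
      (∀ x, x ∈ S → f x < n) ∧ (∀ x y, x ∈ S → y ∈ S → f x = f y → x = y) ∧
      ∀ i, i < n → ∃ x, x ∈ S ∧ f x = i) by_dfn ?_ ?_ hS
  · exact fun T hT => ⟨zero ω, IFun.of M (fun _ => zero ω) by_dfn, fun x hx => (hT x hx).elim,
      fun x _ hx => (hT x hx).elim, fun i hi => (not_lt_zero i hi).elim⟩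
  · rintro S - ⟨n, f, h1, h2, h3⟩ a S' e
    by_cases ha : a ∈ S
    · obtain rfl : S' = S := ISet.ext fun x => (e x).trans ⟨by rintro (rfl | h) <;> assumption, Or.inr⟩
      exact ⟨n, f, h1, h2, h3⟩
    have hne : ∀ x, x ∈ S → x ≠ a := fun x hx h => ha (h ▸ hx)
    let f' : IFun M X (El ω) := IFun.of M (fun x => if x = a then n else f x) by_dfn
    have hfa : f' a = n := if_pos rfl
    have hf : ∀ x, x ∈ S → f' x = f x := fun x hx => if_neg (hne x hx)
    refine ⟨succ n, f', fun x hx => ?_, fun x y hx hy h => ?_, fun i hi => ?_⟩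
    · rcases (e x).1 hx with rfl | hx
      · rw [hfa]
        exact lt_succ_self n
      · rw [hf x hx]
        exact (h1 x hx).trans (lt_succ_self n)
    · rcases (e x).1 hx with rfl | hx <;> rcases (e y).1 hy with rfl | hy
      · rfl
      · rw [hfa, hf y hy] at h
        exact ((h1 y hy).ne h.symm).elim
      · rw [hfa, hf x hx] at h
        exact ((h1 x hx).ne h).elim
      · rw [hf x hx, hf y hy] at h
        exact h2 x y hx hy h
    · rcases (lt_succ_iff.1 hi).lt_or_eq with hi | rfl
      · obtain ⟨x, hx, rfl⟩ := h3 i hi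
        exact ⟨x, (e x).2 (Or.inr hx), hf x hx⟩
      · exact ⟨a, (e a).2 (Or.inl rfl), hfa⟩

/-- Transitivity of `ω`, by induction on `n`. -/
theorem mem_omega_of_mem {n : El ω} {x : M} (hx : x ∈ n.val) : x ∈ ω := by
  suffices h : ∀ x : M, x ∈ n.val → x ∈ ω from h x hx
  refine Omega.induction (P := fun n : El ω => ∀ x : M, x ∈ n.val → x ∈ ω) by_dfn ?_ ?_ n
  · exact fun x hx => (not_mem_zero x hx).elim
  · intro n ih x hx
    rcases mem_succ.1 hx with hx | rfl
    · exact ih x hx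
    · exact n.2

theorem El.ext {a : M} {x y : El a} (h : x.val = y.val) : x = y := Subtype.ext h

variable (ω) in
theorem IFin.isFinite_code {S : ISet M X} (hS : IFin S) : IsFinite ω (code S : M) := by
  obtain ⟨n, f, h1, h2, h3⟩ := hS.exists_enumeration ω
  have hd : ∀ m : El (code S : M), ∃ x, code x = m.val ∧ x ∈ S := fun m => ISet.mem_code.1 m.2
  choose d hd hdS using hd
  let F : El (code S : M) → El n.val := fun m => ⟨(f (d m)).val, h1 _ (hdS m)⟩
  have hF : ∀ m, (F m).val = (f (d m)).val := fun _ => rfl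
  refine ⟨n.val, n.2, F, internalFun_iff_dfnF.2 ?_, ?_, ?_⟩
  · refine DfnF.of_unique (P := fun (m : El (code S : M)) (i : El n.val) =>
      ∃ x : X, code x = m.val ∧ (f x).val = i.val)
      (Dfn.ex (Dfn.and (Dfn.eq DfnF.id.snd.code by_dfn) by_dfn)) fun m i => ⟨?_, ?_⟩
    · rintro rfl
      exact ⟨d m, hd m, rfl⟩
    · rintro ⟨x, hx, hi⟩
      obtain rfl : x = d m := code_injective (hx.trans (hd m).symm)
      exact El.ext hi
  · intro m m' h
    have := h2 _ _ (hdS m) (hdS m')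
      (El.ext (by rw [← hF, ← hF, h]))
    exact El.ext ((hd m).symm.trans ((congrArg code this).trans (hd m')))
  · intro i
    obtain ⟨k, hk⟩ : ∃ k : El ω, k.val = i.val := ⟨⟨i.val, mem_omega_of_mem i.2⟩, rfl⟩
    obtain ⟨x, hx, rfl⟩ := h3 k (lt_iff_val.2 (hk ▸ i.2))
    obtain ⟨m, hm⟩ : ∃ m : El (code S : M), m.val = code x :=
      ⟨⟨code x, ISet.code_mem_code.2 hx⟩, rfl⟩
    refine ⟨m, El.ext ?_⟩
    have : d m = x := code_injective ((hd m).trans hm)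
    rw [hF, this, hk]

end

/-! ## Bridges to the notions of the model -/

section

/-- The topology of a metric with values in an ordered field. -/
@[reducible] def metricTopology {X : Type u} {K : Type u} [Field K] [LinearOrder K]
    [IsStrictOrderedRing K] (d : X → X → K) : TopologicalSpace X where
  IsOpen U := ∀ x ∈ U, ∃ ε : K, 0 < ε ∧ ∀ y, d x y < ε → y ∈ U
  isOpen_univ x _ := ⟨1, one_pos, fun _ _ => trivial⟩
  isOpen_inter U V hU hV x hx := by
    obtain ⟨ε, hε, h⟩ := hU x hx.1
    obtain ⟨δ, hδ, h'⟩ := hV x hx.2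
    exact ⟨min ε δ, lt_min hε hδ, fun y hy =>
      ⟨h y (hy.trans_le (min_le_left _ _)), h' y (hy.trans_le (min_le_right _ _))⟩⟩
  isOpen_sUnion 𝒰 h𝒰 x := by
    rintro ⟨U, hU, hx⟩
    obtain ⟨ε, hε, h⟩ := h𝒰 U hU x hx
    exact ⟨ε, hε, fun y hy => ⟨U, hU, h y hy⟩⟩

variable {R G τ : M} [Field (El R)] [LinearOrder (El R)]

theorem IsMetric.self {d : El G → El G → El R} (hd : IsMetric R d) (x : El G) : d x x = 0 :=
  (hd.eq_zero_iff x x).2 rfl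

theorem IsMetric.nhds_basis [IsStrictOrderedRing (El R)] {d : El G → El G → El R}
    (hd : IsMetric R d) (x : El G) :
    (@nhds _ (metricTopology d) x).HasBasis (fun ε : El R => 0 < ε) fun ε => {y | d x y < ε} := by
  let := metricTopology d
  refine ⟨fun U => ⟨fun hU => ?_, fun ⟨ε, hε, h⟩ => ?_⟩⟩
  · obtain ⟨V, hVU, hV, hx⟩ := mem_nhds_iff.1 hU
    obtain ⟨ε, hε, h⟩ := hV x hx
    exact ⟨ε, hε, fun y hy => hVU (h y hy)⟩
  · refine mem_nhds_iff.2 ⟨{y | d x y < ε}, h, fun y hy => ?_, ?_⟩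
    · refine ⟨ε - d x y, sub_pos.2 hy, fun z hz => ?_⟩
      change d x z < ε
      linarith [hd.triangle x y z]
    · change d x x < ε
      rwa [hd.self]

theorem IsMetricTopology.isOpen_ext [IsStrictOrderedRing (El R)] {d : El G → El G → El R}
    (hτ : IsMetricTopology R τ d) {U : M} (hU : U ∈ τ) :
    @IsOpen _ (metricTopology d) {x : El G | x.val ∈ U} := ((hτ U).1 hU).2

theorem IsMetricTopology.exists_of_isOpen [IsStrictOrderedRing (El R)] {d : El G → El G → El R}
    (hτ : IsMetricTopology R τ d) {S : Set (El G)} (hS : Dfn M fun x => x ∈ S)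
    (ho : @IsOpen _ (metricTopology d) S) : ∃ U : M, U ∈ τ ∧ S = ext G U := by
  let T : ISet M (El G) := ⟨S, hS⟩
  have hT : ∀ x : El G, x.val ∈ (code T : M) ↔ x ∈ S := fun x => ISet.code_mem_code (S := T)
  refine ⟨code T, (hτ _).2 ⟨fun m hm => ?_, fun x hx => ?_⟩, Set.ext fun x => (hT x).symm⟩
  · obtain ⟨x, rfl, -⟩ := ISet.mem_code.1 hm
    exact x.2
  · obtain ⟨ε, hε, h⟩ := ho x ((hT x).1 hx)
    exact ⟨ε, hε, fun y hy => (hT y).2 (h y hy)⟩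

/-- The hypotheses concern open sets of `M` only. They suffice because balls are definable, so every
neighbourhood in the outer topology contains a neighbourhood from `τ`. -/
theorem IsPolishGroup.isTopologicalGroup {ω : M} [Group (El G)] [IsStrictOrderedRing (El R)]
    [DfnLE M (El R)] (hG : IsPolishGroup ω R G τ) {d : El G → El G → El R} (hd : IsMetric R d)
    (hτ : IsMetricTopology R τ d) : @IsTopologicalGroup (El G) (metricTopology d) _ := by
  let := metricTopology d
  have ball : ∀ (x : El G) (S : Set (El G)), S ∈ nhds x → ∃ U : M, U ∈ τ ∧ x.val ∈ U ∧
      ∀ y : El G, y.val ∈ U → y ∈ S := by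
    intro x S hS
    obtain ⟨ε, hε, h⟩ := (hd.nhds_basis x).mem_iff.1 hS
    have hdef : Dfn M fun y => d x y < ε :=
      Dfn.lt (DfnF.comp₂ hd.internal.dfnF by_dfn by_dfn) by_dfn
    obtain ⟨U, hU, e⟩ := hτ.exists_of_isOpen (S := {y | d x y < ε}) hdef (by
      intro y (hy : d x y < ε)
      refine ⟨ε - d x y, sub_pos.2 hy, fun z hz => ?_⟩
      change d x z < ε
      linarith [hd.triangle x y z])
    have e' : ∀ y : El G, y.val ∈ U ↔ d x y < ε := fun y => (Set.ext_iff.1 e y).symm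
    exact ⟨U, hU, (e' x).2 (by rwa [hd.self]), fun y hy => h ((e' y).1 hy)⟩
  have mem : ∀ (x : El G) (U : M), U ∈ τ → x.val ∈ U → {y : El G | y.val ∈ U} ∈ nhds x :=
    fun x U hU hx => (hτ.isOpen_ext hU).mem_nhds hx
  have hmul : ContinuousMul (El G) := by
    refine ⟨continuous_iff_continuousAt.2 fun p S hS => ?_⟩
    obtain ⟨U, hU, hpU, hUS⟩ := ball _ S hS
    obtain ⟨V, V', hV, hV', hp, hp', h⟩ := hG.continuous_mul p.1 p.2 U hU hpU
    rw [Filter.mem_map, nhds_prod_eq]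
    exact Filter.mem_of_superset (Filter.prod_mem_prod (mem _ V hV hp) (mem _ V' hV' hp'))
      fun q hq => hUS _ (h _ _ hq.1 hq.2)
  have hinv : ContinuousInv (El G) := by
    refine ⟨continuous_iff_continuousAt.2 fun x S hS => ?_⟩
    obtain ⟨U, hU, hxU, hUS⟩ := ball _ S hS
    obtain ⟨V, hV, hx, h⟩ := hG.continuous_inv x U hU hxU
    exact Filter.mem_map.2 <| Filter.mem_of_superset (mem _ V hV hx) fun y hy => hUS _ (h y hy)
  exact {}

/-- A countable coset space gives an invariant of elements that takes values in the natural numbers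
and distinguishes cosets. -/
theorem exists_cosetIndex {ω C : M} [Fact (IsOmega ω)] [Group (El G)] [DfnMul M (El G)]
    (F : Subgroup (El G)) [DfnSubgroup M F] (hC : IsCosetSpace ⊤ F C) (hcount : IsCountable ω C) :
    ∃ κ : IFun M (El G) (El ω), ∀ g h, κ g = κ h → g⁻¹ * h ∈ F := by
  obtain ⟨f, hf, hinj⟩ := hcount
  let f' : IFun M (El C) (El ω) := IFun.of M f (internalFun_iff_dfnF.1 hf)
  have hex : ∀ g : El G, ∃ c : El C, ∀ x : M, x ∈ c.val ↔ ∃ h : El G, h ∈ F ∧ (g * h).val = x := by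
    intro g
    let S : ISet M (El G) := ISet.of M (fun x => ∃ h, h ∈ F ∧ g * h = x) by_dfn
    have hS : ∀ x : M, x ∈ (code S : M) ↔ ∃ h : El G, h ∈ F ∧ (g * h).val = x := by
      intro x
      rw [ISet.mem_code]
      constructor
      · rintro ⟨_, rfl, h, hh, rfl⟩
        exact ⟨h, hh, rfl⟩
      · rintro ⟨h, hh, rfl⟩
        exact ⟨_, rfl, h, hh, rfl⟩
    exact ⟨⟨code S, (hC _).2 ⟨g, Subgroup.mem_top g, hS⟩⟩, hS⟩
  -- The coset is unique by extensionality, so this map is definable.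
  choose c hc using hex
  have hcF : DfnF M c := by
    refine DfnF.of_unique (P := fun (g : El G) (d : El C) => ∀ x : M, x ∈ d.val ↔
      ∃ h : El G, h ∈ F ∧ (g * h).val = x) by_dfn fun g d => ⟨?_, fun h => ?_⟩
    · rintro rfl
      exact hc g
    · exact El.ext (ext_of_mem fun x => (hc g x).trans (h x).symm)
  refine ⟨IFun.of M (fun g => f' (c g)) (DfnF.app by_dfn hcF), fun g h hgh => ?_⟩
  have e : c g = c h := hinj hgh
  have h1 : h.val ∈ (c h).val := (hc h _).2 ⟨1, F.one_mem, by rw [mul_one]⟩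
  rw [← e] at h1
  obtain ⟨k, hk, hk'⟩ := (hc g _).1 h1
  obtain rfl : g * k = h := El.ext hk'
  simpa using hk

/-- If finitely many cosets of `F` cover `H`, the coset space of `F` in `H` is finite. -/
theorem exists_finite_cosetSpace (ω : M) [Fact (IsOmega ω)] [Group (El G)] [DfnMul M (El G)]
    (F H : Subgroup (El G)) [DfnSubgroup M F] [DfnSubgroup M H] {Y : ISet M (El G)} (hY : IFin Y)
    (hcov : ∀ h, h ∈ H → ∃ y, y ∈ Y ∧ y⁻¹ * h ∈ F) :
    ∃ C : M, IsCosetSpace H F C ∧ IsFinite ω C := by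
  let cos : El G → ISet M (El G) := fun g => ISet.of M (fun x => g⁻¹ * x ∈ F) by_dfn
  have hcos : ∀ g x, x ∈ cos g ↔ g⁻¹ * x ∈ F := fun _ _ => Iff.rfl
  have hcosF : DfnF M cos := DfnF.of_unique (P := fun g S => ∀ x, x ∈ S ↔ g⁻¹ * x ∈ F) by_dfn
    fun g S => ⟨by rintro rfl; exact hcos g, fun h => ISet.ext fun x => (h x).symm⟩
  let κ : IFun M (El G) (ISet M (El G)) := IFun.of M cos hcosF
  have hκ : ∀ g, κ g = cos g := fun _ => rfl
  clear_value κ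
  let S : ISet M (ISet M (El G)) := ISet.of M (fun T => ∃ g, g ∈ H ∧ κ g = T) by_dfn
  have hS : IFin S := by
    -- Each coset of `F` in `H` is the coset of some point of `Y`, so the coset space is a subset of
    -- a finite image.
    obtain ⟨U, hU, hU'⟩ := hY.exists_image κ
    refine hU.subset ?_
    rintro _ ⟨g, hg, rfl⟩
    obtain ⟨y, hy, hyg⟩ := hcov g hg
    refine (hU' _).2 ⟨y, hy, ?_⟩
    rw [hκ, hκ]
    refine ISet.ext fun x => ?_
    rw [hcos, hcos]
    have e : y⁻¹ * x = (y⁻¹ * g) * (g⁻¹ * x) := by group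
    rw [e, Subgroup.mul_mem_cancel_left F hyg]
  have hcode : ∀ (c : M) (g : El G), c = code (cos g) ↔
      ∀ x : M, x ∈ c ↔ ∃ f : El G, f ∈ F ∧ (g * f).val = x := by
    intro c g
    have h1 : ∀ x : M, x ∈ (code (cos g) : M) ↔ ∃ f : El G, f ∈ F ∧ (g * f).val = x := by
      intro x
      rw [ISet.mem_code]
      constructor
      · rintro ⟨y, rfl, hy⟩
        exact ⟨g⁻¹ * y, hy, by rw [mul_inv_cancel_left]; rfl⟩
      · rintro ⟨f, hf, rfl⟩
        exact ⟨g * f, rfl, (hcos _ _).2 (by rwa [inv_mul_cancel_left])⟩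
    refine ⟨by rintro rfl; exact h1, fun h => ext_of_mem fun x => (h x).trans (h1 x).symm⟩
  refine ⟨code S, fun c => ?_, hS.isFinite_code ω⟩
  rw [ISet.mem_code]
  constructor
  · rintro ⟨_, rfl, g, hg, rfl⟩
    exact ⟨g, hg, (hcode _ g).1 (by rw [hκ])⟩
  · rintro ⟨g, hg, h⟩
    exact ⟨κ g, by rw [(hcode c g).2 h, hκ], g, hg, rfl⟩

end

end

end SetModel

/-! ### Main theorem: the closure of `F` is the required subgroup -/

open SetModel in
theorem mainTheorem12 {M : Type*} [Membership M M] (hM : IsModelZFDC M)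
    -- the natural numbers and the real line of the model
    (ω : M) (hω : IsOmega ω)
    (R : M) [Field (El R)] [LinearOrder (El R)] (hR : IsRealLine R)
    -- there is no Vitali set in the model
    (hV : ¬ ∃ T : M, IsVitaliSet R T)
    -- a Polish group of the model and a subgroup of countable index
    (G τ : M) [Group (El G)] (hG : IsPolishGroup ω R G τ)
    (F : Subgroup (El G)) (hF : Internal (F : Set (El G)))
    (hindex : ∃ C : M, IsCosetSpace ⊤ F C ∧ IsCountable ω C) :
    ∃ G₀ : Subgroup (El G),
      (∃ U : M, U ∈ τ ∧ ((G₀ : Set (El G)) = ext G U)) ∧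
      F ≤ G₀ ∧
      (∃ C : M, IsCosetSpace G₀ F C ∧ IsFinite ω C) ∧
      (F.Normal → G₀.Normal) := by
  have : ZFDC M := ⟨hM⟩
  have : Fact (IsOmega ω) := ⟨hω⟩
  have := hR.orderedField
  have : DfnAdd M (El R) := ⟨hR.add_internal.dfnF⟩
  have : DfnMul M (El R) := ⟨hR.mul_internal.dfnF⟩
  have : DfnLE M (El R) := ⟨internalRel_iff_dfn.1 hR.le_internal⟩
  have : ISupClosed M (El R) := ⟨fun S ⟨x, hx⟩ ⟨b, hb⟩ => by
    obtain ⟨c, hc⟩ := hR.complete {x | x ∈ S} (internal_iff_dfn.2 S.dfn) ⟨x, hx⟩ ⟨b, hb⟩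
    exact ⟨c, fun x hx => hc.1 hx, fun d hd => hc.2 hd⟩⟩
  have : DfnMul M (El G) := ⟨hG.mul_internal.dfnF⟩
  have : DfnSubgroup M F := ⟨internal_iff_dfn.1 hF⟩
  obtain ⟨d, hd, hcomp, -, hτ⟩ := hG.polish
  let := metricTopology d
  have : IsTopologicalGroup (El G) := hG.isTopologicalGroup hd hτ
  let D : IFun M (El G × El G) (El R) := IFun.of M (fun p => d p.1 p.2) hd.internal.dfnF
  have hD : IsCompatibleMetric D := ⟨hd.eq_zero_iff, hd.symm, hd.triangle, hd.nhds_basis⟩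
  have hC : IsCauchyComplete ω D := fun s hs => hcomp s (internalFun_iff_dfnF.2 s.dfn) hs
  obtain ⟨C, hCos, hcount⟩ := hindex
  obtain ⟨κ, hκ⟩ := exists_cosetIndex F hCos hcount
  have := hD.dfnSubgroup_closure F
  refine ⟨F.topologicalClosure, ?_, F.le_topologicalClosure, ?_, fun h => ?_⟩
  · exact hτ.exists_of_isOpen (DfnSubgroup.mem (S := F.topologicalClosure))
      (isOpen_topologicalClosure hD hC F κ hκ)
  -- If the coset space is not finite, no finite set of cosets covers the closure, and the Vitali
  -- set constructed from this contradicts `hV`.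
  · by_contra hfin
    obtain ⟨T, hT⟩ := exists_vitali hD hC F κ hκ fun ⟨Y, hY, hcov⟩ =>
      hfin (exists_finite_cosetSpace ω F _ hY hcov)
    have hrat : ∀ x : El R, IsRat M x ↔ IsRational x := fun x =>
      forall_congr' fun S => imp_congr internal_iff_dfn.symm Iff.rfl
    have hcode : ∀ t : El R, t.val ∈ (Coded.code T : M) ↔ t ∈ T := fun t => ISet.code_mem_code
    refine hV ⟨Coded.code T, fun t ht => ?_, fun x => ?_⟩
    · obtain ⟨x, rfl, -⟩ := ISet.mem_code.1 ht
      exact x.2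
    · simpa only [hcode, hrat] using hT x
  · exact Subgroup.is_normal_topologicalClosure F
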